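/- **Setting.** Let $d\to\infty$ and let $m,k,n,p,r$ be positive integers depending on $d$. For random matrices $A,\overline A\in\mathbb R^{k\times n}$ and $\overline W\in\mathbb R^{m\times k}$ put $$\mathcal L(W)=\tfrac1{2n}\|WA-\overline W\,\overline A\|_F^2\quad(W\in\mathbb R^{m\times k}),\qquad B=\tfrac1nAA^\top,\qquad \overline B=\tfrac1n\overline AA^\top ,$$ and let $W_0=0$, $W_{t+1}=W_t-\eta\nabla\mathcal L(W_t)$ with $\eta=\frac1{c\|B\|_{\rm op}}$ for a constant $c\ge1$. The nuclear rank of a matrix $G$ is $\mathrm{nr}(G)=\|G\|_*^2/\|G\|_F^2$. **Multi-spiked teacher–student model.** Fix constants $0<c_1\le c_2<\infty$ and $0<\ell\le u\le1$. The pair $(A,\overline A)$ satisfies the model if $B=H_1+\Gamma$ and $\overline B=H_2+\Sigma$, where * (spikes) $H_1=UQU^\top$ and $H_2=V\overline QU^\top$ for some $U,V\in\mathbb R^{k\times p}$ with orthonormal columns and some diagonal matrices $Q,\overline Q\in\mathbb R^{p\times p}$ with non-increasing diagonal entries, all lying in $[c_1d^\ell,c_2d^u]$, and the largest entry of $Q$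 is at least $c_1d^u$; * (bulk) $\Gamma$ is symmetric with $c_1I\preceq\Gamma\preceq c_2I$, and the $r$ largest singular values of $\Sigma$ lie in $[c_1,c_2]$. **Claim.** Suppose that $\overline W$ has i.i.d. entries $\mathcal N(0,1/d)$ and is independent of $(A,\overline A)$, and that $u-\ell<\frac12$, $p=o(d^{1-2(u-\ell)})$, $k/d\to\gamma\in(0,\infty)$, $m\asymp d$ and $r\asymp d$ as $d\to\infty$. Then there is a constant $C_1>0$ such that for every $C_3>0$ there is a constant $C_2>0$ for which the conditional probability given $(A,\overline A)$ of the event $$\mathrm{nr}(\nabla\mathcal L(W_t))\ \ge\ C_2\,d\qquad\text{for all integers }t\in[C_1d^{u-\ell}\log d,\;C_3d^u]$$ tends to one as $d\to\infty$, uniformly over almost all realizations of $(A,\overline A)$ that satisfy the model; that is, for every $\delta>0$ and all sufficiently large $d$, this conditional probability is at least $1-\delta$ for almost every realization of $(A,\overline A)$ that satisfies the model. -/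

import Mathlib

open MeasureTheory ProbabilityTheory Filter Asymptotics
open scoped Matrix NNReal Topology

noncomputable section

namespace MultiSpike

/-- Singular values of a real matrix in non-increasing order, repeated with multiplicity and
indexed from `0`: `singularValue M j` is the `(j+1)`-st largest one (zero past the rank). -/
def singularValue {a b : ℕ} (M : Matrix (Fin a) (Fin b) ℝ) (j : ℕ) : ℝ :=
  (Matrix.toEuclideanLin M).singularValues j

/-- Nuclear norm: the sum of the singular values. -/
def nuclearNorm {a b : ℕ} (M : Matrix (Fin a) (Fin b) ℝ) : ℝ :=
  ∑ j ∈ Finset.range b, singularValue M j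

/-- Frobenius norm. -/
def frobNorm {a b : ℕ} (M : Matrix (Fin a) (Fin b) ℝ) : ℝ :=
  √(∑ i, ∑ j, M i j ^ 2)

/-- Operator (spectral) norm of a square matrix. -/
def opNorm {a : ℕ} (M : Matrix (Fin a) (Fin a) ℝ) : ℝ :=
  ‖Matrix.toEuclideanCLM (n := Fin a) (𝕜 := ℝ) M‖

/-- Nuclear rank. -/
def nuclearRank {a b : ℕ} (M : Matrix (Fin a) (Fin b) ℝ) : ℝ :=
  nuclearNorm M ^ 2 / frobNorm M ^ 2

/-- Gradient of a function of a matrix (Frobenius inner product): the matrix of its partial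
derivatives with respect to the entries. -/
def matrixGradient {a b : ℕ} (f : Matrix (Fin a) (Fin b) ℝ → ℝ)
    (W : Matrix (Fin a) (Fin b) ℝ) : Matrix (Fin a) (Fin b) ℝ :=
  Matrix.of fun i j => lineDeriv ℝ f W (Matrix.single i j 1)

/-- The least squares loss `L(W) = (1/2n) ‖W A - Wbar Abar‖_F²`. -/
def loss {m k n : ℕ} (A Abar : Matrix (Fin k) (Fin n) ℝ) (Wbar W : Matrix (Fin m) (Fin k) ℝ) : ℝ :=
  1 / (2 * (n : ℝ)) * frobNorm (W * A - Wbar * Abar) ^ 2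

/-- Gradient descent on `loss A Abar Wbar` with step `η`, started at the zero matrix. -/
def gdIterate {m k n : ℕ} (A Abar : Matrix (Fin k) (Fin n) ℝ) (Wbar : Matrix (Fin m) (Fin k) ℝ)
    (η : ℝ) : ℕ → Matrix (Fin m) (Fin k) ℝ
  | 0 => 0
  | t + 1 => gdIterate A Abar Wbar η t -
      η • matrixGradient (loss A Abar Wbar) (gdIterate A Abar Wbar η t)

/-- The Gram matrix `B = (1/n) A Aᵀ`. -/
def gram {k n : ℕ} (A : Matrix (Fin k) (Fin n) ℝ) : Matrix (Fin k) (Fin k) ℝ :=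
  (1 / (n : ℝ)) • (A * Aᵀ)

/-- The cross-Gram matrix `(1/n) Abar Aᵀ`. -/
def crossGram {k n : ℕ} (A Abar : Matrix (Fin k) (Fin n) ℝ) : Matrix (Fin k) (Fin k) ℝ :=
  (1 / (n : ℝ)) • (Abar * Aᵀ)

/-- The multi-spiked teacher–student model:
`(1/n) A Aᵀ = H₁ + Γ` and `(1/n) Abar Aᵀ = H₂ + S`, where
* `H₁ = U diag(q) Uᵀ` and `H₂ = V diag(qbar) Uᵀ` are compact singular value decompositions of
  rank `p` with the same right factor `U`; all their singular values lie in
  `[c₁ d^ℓ, c₂ d^u]`, and the largest one of `H₁` has exact order `d^u`;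
* `c₁ I ⪯ Γ ⪯ c₂ I`, and the `r` largest singular values of `S` lie in `[c₁, c₂]`. -/
def MultiSpiked (d p r : ℕ) (c₁ c₂ ℓ u : ℝ) {k n : ℕ} (A Abar : Matrix (Fin k) (Fin n) ℝ) : Prop :=
  ∃ (H₁ H₂ Γ S : Matrix (Fin k) (Fin k) ℝ) (U V : Matrix (Fin k) (Fin p) ℝ) (q qbar : Fin p → ℝ),
    gram A = H₁ + Γ ∧ crossGram A Abar = H₂ + S ∧
    Uᵀ * U = 1 ∧ Vᵀ * V = 1 ∧ Antitone q ∧ Antitone qbar ∧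
    H₁ = U * Matrix.diagonal q * Uᵀ ∧ H₂ = V * Matrix.diagonal qbar * Uᵀ ∧
    (∀ i, q i ∈ Set.Icc (c₁ * (d : ℝ) ^ ℓ) (c₂ * (d : ℝ) ^ u)) ∧
    (∀ i, qbar i ∈ Set.Icc (c₁ * (d : ℝ) ^ ℓ) (c₂ * (d : ℝ) ^ u)) ∧
    (∃ i, c₁ * (d : ℝ) ^ u ≤ q i) ∧
    (Γ - c₁ • (1 : Matrix (Fin k) (Fin k) ℝ)).PosSemidef ∧
    (c₂ • (1 : Matrix (Fin k) (Fin k) ℝ) - Γ).PosSemidef ∧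
    ∀ j < r, singularValue S j ∈ Set.Icc c₁ c₂

/-- The σ-algebra generated by a pair of random matrices (that is, by all their entries). -/
abbrev sigmaPair {Ω : Type*} {k n : ℕ} (A Abar : Ω → Matrix (Fin k) (Fin n) ℝ) : MeasurableSpace Ω :=
  MeasurableSpace.comap (fun ω => ((fun i j => A ω i j, fun i j => Abar ω i j) :
    (Fin k → Fin n → ℝ) × (Fin k → Fin n → ℝ))) inferInstance

/-- The event that `nr(∇L(W_t)) ≥ C₂ d` for every iteration `t` of gradient descent with step
`η = 1 / (c ‖B‖_op)` in the window `C₁ d^(u-ℓ) log d ≤ t ≤ C₃ d^u`. -/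
def largeNuclearRankEvent {Ω : Type*} (d : ℕ) {m k n : ℕ} (c ℓ u C₁ C₂ C₃ : ℝ)
    (A Abar : Ω → Matrix (Fin k) (Fin n) ℝ) (Wbar : Ω → Matrix (Fin m) (Fin k) ℝ) : Set Ω :=
  {ω | ∀ t : ℕ, C₁ * (d : ℝ) ^ (u - ℓ) * Real.log d ≤ t → (t : ℝ) ≤ C₃ * (d : ℝ) ^ u →
    C₂ * d ≤ nuclearRank (matrixGradient (loss (A ω) (Abar ω) (Wbar ω))
      (gdIterate (A ω) (Abar ω) (Wbar ω) (1 / (c * opNorm (gram (A ω)))) t))}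

end MultiSpike

end

/-! Write B̄ for the cross-Gram matrix and W̄ for the teacher. The gradient is affine in W, so along
gradient descent from zero it equals -W̄ B̄ P with P = (1 - ηB)^t (`matrixGradient_gdIterate`). The
eigenvalues of B split into at most p spikes, of size at least c₁ d^ℓ, and a bulk in [0, c₂]
(`spiked_eigenvalues`), while ‖B‖ has order d^u. In the time window P therefore shrinks the spikes
by a factor 1/d (`mul_one_sub_pow_le`) but keeps a constant fraction of the bulk
(`exp_le_one_sub_pow`). The lower end of the window fixes C₁; the upper end enters only through the
factor ρ = exp(2C₃c₂/(c c₁)), hence only in C₂.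

Frobenius norm, from above. Since BP is bounded, UᵀP = O(d^(-ℓ)) (`norm_spike_mul_le`), so the spike
part of B̄P is V X with ‖X‖ = O(d^(u-ℓ)). Its contribution ‖W̄VX‖_F² is of order p d^(2(u-ℓ)) in
mean, which is o(d) by the assumption on p. The bulk part contributes at most c₂²‖W̄‖_F² = O(d).

Nuclear norm, from below. Let D be spanned by the columns of U and the spike eigenvectors, so dim D
≤ 2p. A matrix R of norm at most ρ inverts P on the bulk, and B̄PR coincides with the bulk S of B̄
on Dᗮ (`MultiSpiked.exists_structure`). It remains to test W̄S against an orthonormal system in Dᗮ.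
Gram–Schmidt on the rows of W̄S supplies one, and each row far from D and its predecessors adds a
constant to the trace (`card_mul_le_nuclearNorm`). Given its predecessors, a Gaussian row has
expected squared distance at least (‖S‖_F² - dim · ‖S‖²)/d, which is bounded below for the first θd
rows because r ≍ d. Chebyshev and Markov make at least half of them good
(`gaussianMatrix_card_nearSpan_le`).

So the nuclear norm is of order at least d, the squared Frobenius norm O(d), and the quotient of
order at least d. The exceptional Gaussian events involve V, S and D but not t, so the whole window
is covered without a union bound over t. Independence turns the conditional probability into the
Gaussian measure of a slice (`condExp_indicator_prodMk_ae_eq`), and the estimate is uniform over the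
model. -/

namespace MultiSpike

open scoped Matrix.Norms.L2Operator

/-! ### Singular values, Frobenius and nuclear norms, trace duality -/

section LinearAlgebra

/-- The sum of the squared norms of the images of an orthonormal basis does not depend on the
basis. -/
theorem sum_norm_sq_apply_eq {E F ι κ : Type*} [NormedAddCommGroup E] [InnerProductSpace ℝ E]
    [FiniteDimensional ℝ E] [NormedAddCommGroup F] [InnerProductSpace ℝ F] [FiniteDimensional ℝ F]
    [Fintype ι] [Fintype κ] (T : E →ₗ[ℝ] F) (b : OrthonormalBasis ι ℝ E)
    (e : OrthonormalBasis κ ℝ F) :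
    ∑ i, ‖T (b i)‖ ^ 2 = ∑ j, ‖LinearMap.adjoint T (e j)‖ ^ 2 := by
  simp_rw [← e.sum_sq_inner_right, ← b.sum_sq_inner_right, LinearMap.adjoint_inner_right]
  rw [Finset.sum_comm]
  simp_rw [real_inner_comm]

variable {a b c : ℕ}

theorem toEuclideanLin_apply_coord (M : Matrix (Fin a) (Fin b) ℝ) (x : EuclideanSpace ℝ (Fin b))
    (i : Fin a) : Matrix.toEuclideanLin M x i = ∑ j, M i j * x j := by
  simp [Matrix.toLpLin_apply, Matrix.mulVec, dotProduct]

theorem frobNorm_sq (M : Matrix (Fin a) (Fin b) ℝ) : frobNorm M ^ 2 = ∑ i, ∑ j, M i j ^ 2 :=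
  Real.sq_sqrt (by positivity)

theorem frobNorm_sq_eq_sum_row (M : Matrix (Fin a) (Fin b) ℝ) :
    frobNorm M ^ 2 = ∑ i, ‖WithLp.toLp 2 (M i)‖ ^ 2 := by
  simp [frobNorm_sq, EuclideanSpace.real_norm_sq_eq]

theorem toEuclideanLin_transpose (M : Matrix (Fin a) (Fin b) ℝ) :
    Matrix.toEuclideanLin Mᵀ = LinearMap.adjoint (Matrix.toEuclideanLin M) := by
  rw [← Matrix.toEuclideanLin_conjTranspose_eq_adjoint, Matrix.conjTranspose_eq_transpose_of_trivial]

theorem frobNorm_sq_eq_sum_basis {ι : Type*} [Fintype ι] (M : Matrix (Fin a) (Fin b) ℝ)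
    (v : OrthonormalBasis ι ℝ (EuclideanSpace ℝ (Fin b))) :
    frobNorm M ^ 2 = ∑ j, ‖Matrix.toEuclideanLin M (v j)‖ ^ 2 := by
  rw [sum_norm_sq_apply_eq _ v (EuclideanSpace.basisFun (Fin a) ℝ), frobNorm_sq_eq_sum_row]
  refine Finset.sum_congr rfl fun i _ => ?_
  congr 2
  ext j
  rw [← toEuclideanLin_transpose, toEuclideanLin_apply_coord]
  simp

theorem frobNorm_add_sq_le (M N : Matrix (Fin a) (Fin b) ℝ) :
    frobNorm (M + N) ^ 2 ≤ 2 * frobNorm M ^ 2 + 2 * frobNorm N ^ 2 := by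
  simp only [frobNorm_sq, Finset.mul_sum, ← Finset.sum_add_distrib, Matrix.add_apply]
  gcongr with i _ j _
  nlinarith [sq_nonneg (M i j - N i j)]

theorem frobNorm_neg (M : Matrix (Fin a) (Fin b) ℝ) : frobNorm (-M) = frobNorm M := by
  simp [frobNorm]

theorem norm_transpose (M : Matrix (Fin a) (Fin b) ℝ) : ‖Mᵀ‖ = ‖M‖ := by
  rw [← Matrix.conjTranspose_eq_transpose_of_trivial, Matrix.l2_opNorm_conjTranspose]

theorem norm_toEuclideanLin_apply_le (M : Matrix (Fin a) (Fin b) ℝ)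
    (x : EuclideanSpace ℝ (Fin b)) : ‖Matrix.toEuclideanLin M x‖ ≤ ‖M‖ * ‖x‖ :=
  Matrix.l2_opNorm_mulVec M x

theorem norm_le_of_toEuclideanLin (M : Matrix (Fin a) (Fin b) ℝ) {K : ℝ} (hK : 0 ≤ K)
    (h : ∀ x, ‖Matrix.toEuclideanLin M x‖ ≤ K * ‖x‖) : ‖M‖ ≤ K := by
  rw [Matrix.l2_opNorm_def]
  exact ContinuousLinearMap.opNorm_le_bound _ hK h

/-- Each row of the product is the image under Xᵀ of a row of M. This separates the Gaussian factor,
measured in Frobenius norm, from the deterministic filter, measured in operator norm. -/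
theorem frobNorm_mul_sq_le (M : Matrix (Fin a) (Fin b) ℝ) (X : Matrix (Fin b) (Fin c) ℝ) :
    frobNorm (M * X) ^ 2 ≤ ‖X‖ ^ 2 * frobNorm M ^ 2 := by
  simp only [frobNorm_sq_eq_sum_row, Finset.mul_sum]
  gcongr with i _
  rw [← mul_pow, ← norm_transpose X]
  gcongr
  have h : WithLp.toLp 2 ((M * X) i) = Matrix.toEuclideanLin Xᵀ (WithLp.toLp 2 (M i)) := by
    ext j
    rw [toEuclideanLin_apply_coord]
    simp [Matrix.mul_apply, mul_comm]
  rw [h]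
  exact norm_toEuclideanLin_apply_le _ _

/-- An orthonormal basis of right singular vectors. -/
theorem exists_rightSingularBasis (M : Matrix (Fin a) (Fin b) ℝ) :
    ∃ v : OrthonormalBasis (Fin b) ℝ (EuclideanSpace ℝ (Fin b)),
      (∀ j, ‖Matrix.toEuclideanLin M (v j)‖ = singularValue M j) ∧
      ∀ i j, i ≠ j → inner ℝ (Matrix.toEuclideanLin M (v i)) (Matrix.toEuclideanLin M (v j)) = 0 := by
  set T := Matrix.toEuclideanLin M
  have hn : Module.finrank ℝ (EuclideanSpace ℝ (Fin b)) = b := finrank_euclideanSpace_fin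
  have key : ∀ i j, inner ℝ (T (T.isSymmetric_adjoint_comp_self.eigenvectorBasis hn i))
      (T (T.isSymmetric_adjoint_comp_self.eigenvectorBasis hn j)) =
      T.isSymmetric_adjoint_comp_self.eigenvalues hn j * if i = j then 1 else 0 := by
    intro i j
    rw [← LinearMap.adjoint_inner_right, ← LinearMap.comp_apply,
      LinearMap.IsSymmetric.apply_eigenvectorBasis, inner_smul_right,
      orthonormal_iff_ite.1 (T.isSymmetric_adjoint_comp_self.eigenvectorBasis hn).orthonormal]
    rfl
  refine ⟨T.isSymmetric_adjoint_comp_self.eigenvectorBasis hn, fun j => ?_, fun i j hij => ?_⟩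
  · have := key j j
    rw [if_pos rfl, mul_one, real_inner_self_eq_norm_sq] at this
    rw [singularValue, T.singularValues_fin hn, ← this, Real.sqrt_sq (norm_nonneg _)]
  · rw [key, if_neg hij, mul_zero]

theorem singularValue_nonneg (M : Matrix (Fin a) (Fin b) ℝ) (j : ℕ) : 0 ≤ singularValue M j :=
  LinearMap.singularValues_nonneg _ j

theorem nuclearNorm_eq_sum_fin (M : Matrix (Fin a) (Fin b) ℝ) :
    nuclearNorm M = ∑ j : Fin b, singularValue M j :=
  Finset.sum_range _

theorem trace_eq_sum_inner_basis {ι : Type*} [Fintype ι] (M : Matrix (Fin a) (Fin a) ℝ)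
    (v : OrthonormalBasis ι ℝ (EuclideanSpace ℝ (Fin a))) :
    M.trace = ∑ j, inner ℝ (v j) (Matrix.toEuclideanLin M (v j)) := by
  rw [← LinearMap.trace_eq_sum_inner _ v, Matrix.toEuclideanLin, Matrix.toLpLin_eq_toLin,
    Matrix.trace_toLin_eq]

theorem toEuclideanLin_mul (M : Matrix (Fin a) (Fin b) ℝ) (N : Matrix (Fin b) (Fin c) ℝ)
    (x : EuclideanSpace ℝ (Fin c)) : Matrix.toEuclideanLin (M * N) x =
      Matrix.toEuclideanLin M (Matrix.toEuclideanLin N x) := by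
  simp [Matrix.toLpLin_apply]

/-- Trace duality between the nuclear norm and the operator norm. -/
theorem trace_mul_le_nuclearNorm (M : Matrix (Fin a) (Fin b) ℝ) (Y : Matrix (Fin b) (Fin a) ℝ) :
    (M * Y).trace ≤ ‖Y‖ * nuclearNorm M := by
  obtain ⟨v, hv, -⟩ := exists_rightSingularBasis M
  rw [Matrix.trace_mul_comm, trace_eq_sum_inner_basis _ v, nuclearNorm_eq_sum_fin, Finset.mul_sum]
  refine Finset.sum_le_sum fun j _ => (real_inner_le_norm _ _).trans ?_
  rw [v.norm_eq_one, one_mul, toEuclideanLin_mul, ← hv]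
  exact norm_toEuclideanLin_apply_le _ _

/-- The nuclear norm is attained in the trace duality. -/
theorem exists_trace_mul_eq_nuclearNorm (M : Matrix (Fin a) (Fin b) ℝ) :
    ∃ Y : Matrix (Fin b) (Fin a) ℝ, ‖Y‖ ≤ 1 ∧ (M * Y).trace = nuclearNorm M := by
  obtain ⟨v, hv, ho⟩ := exists_rightSingularBasis M
  -- The adjoint of the polar factor of M: it sends M vⱼ / σⱼ to vⱼ. Since 0⁻¹ = 0, vanishing
  -- singular values drop out.
  let T : EuclideanSpace ℝ (Fin a) →ₗ[ℝ] EuclideanSpace ℝ (Fin b) :=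
    ∑ j : Fin b, ((singularValue M j)⁻¹ • (innerₗ _ (Matrix.toEuclideanLin M (v j)))).smulRight (v j)
  have hT : ∀ x, T x = ∑ j : Fin b, ((singularValue M j)⁻¹ *
      inner ℝ (Matrix.toEuclideanLin M (v j)) x) • v j := by
    intro x; simp [T]
  have hM : Matrix.toEuclideanLin (Matrix.toEuclideanLin.symm T) = T :=
    LinearEquiv.apply_symm_apply _ _
  refine ⟨Matrix.toEuclideanLin.symm T, norm_le_of_toEuclideanLin _ zero_le_one fun x => ?_, ?_⟩
  · rw [hM, one_mul]
    refine le_of_sq_le_sq ?_ (norm_nonneg _)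
    rw [← v.sum_sq_inner_right]
    have : ∀ j, inner ℝ (v j) (T x) =
        (singularValue M j)⁻¹ * inner ℝ (Matrix.toEuclideanLin M (v j)) x := by
      intro j
      rw [hT, v.orthonormal.inner_right_fintype]
    simp_rw [this]
    -- The normalized left singular vectors are orthonormal but need not span, so the norm bound is
    -- Bessel's inequality.
    let w : {j : Fin b // singularValue M j ≠ 0} → EuclideanSpace ℝ (Fin a) :=
      fun j => (singularValue M j)⁻¹ • Matrix.toEuclideanLin M (v j)
    have hw : Orthonormal ℝ w := by
      refine ⟨fun j => ?_, fun i j hij => ?_⟩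
      · simp only [w]
        rw [norm_smul, hv, norm_inv, Real.norm_of_nonneg (singularValue_nonneg _ _),
          inv_mul_cancel₀ j.2]
      · simp only [w]
        rw [inner_smul_left, inner_smul_right, ho _ _ (fun h => hij (Subtype.ext h)), mul_zero,
          mul_zero]
    have h1 := hw.sum_inner_products_le x (s := Finset.univ)
    refine le_trans (le_of_eq ?_) h1
    have h2 : ∀ j : Fin b, ((singularValue M j)⁻¹ *
        inner ℝ (Matrix.toEuclideanLin M (v j)) x) ^ 2 ≠ 0 → singularValue M j ≠ 0 := by
      intro j hj h0
      simp [h0] at hj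
    rw [← Finset.sum_filter_of_ne (fun j _ => h2 j),
      Finset.sum_subtype _ (p := fun j : Fin b => singularValue M j ≠ 0) (by simp)]
    refine Finset.sum_congr rfl fun j _ => ?_
    simp only [w]
    rw [inner_smul_left, Real.norm_eq_abs, sq_abs]
    rfl
  · rw [Matrix.trace_mul_comm, trace_eq_sum_inner_basis _ v, nuclearNorm_eq_sum_fin]
    refine Finset.sum_congr rfl fun j _ => ?_
    rw [toEuclideanLin_mul, hM, hT, v.orthonormal.inner_right_fintype, real_inner_self_eq_norm_sq,
      hv]
    by_cases h : singularValue M j = 0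
    · simp [h]
    · field_simp

theorem sum_sq_singularValue (M : Matrix (Fin a) (Fin b) ℝ) :
    frobNorm M ^ 2 = ∑ j : Fin b, singularValue M j ^ 2 := by
  obtain ⟨v, hv, -⟩ := exists_rightSingularBasis M
  simp_rw [frobNorm_sq_eq_sum_basis M v, hv]

/-- The images of the right singular basis are orthogonal, so ‖Mx‖² = Σ σⱼ² ⟨vⱼ, x⟩² by Pythagoras.
This is what converts the model's bound on singular values of the bulk into an operator norm bound.
-/
theorem norm_le_singularValue_zero (M : Matrix (Fin a) (Fin b) ℝ) : ‖M‖ ≤ singularValue M 0 := by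
  obtain ⟨v, hv, ho⟩ := exists_rightSingularBasis M
  refine norm_le_of_toEuclideanLin M (singularValue_nonneg _ _) fun x => ?_
  refine le_of_sq_le_sq ?_ (mul_nonneg (singularValue_nonneg _ _) (norm_nonneg _))
  have hx : Matrix.toEuclideanLin M x =
      ∑ j, inner ℝ (v j) x • Matrix.toEuclideanLin M (v j) := by
    conv_lhs => rw [← v.sum_repr' x]
    simp
  have h1 : ‖Matrix.toEuclideanLin M x‖ ^ 2 = ∑ j : Fin b, inner ℝ (v j) x ^ 2 * singularValue M j ^ 2 := by
    rw [← real_inner_self_eq_norm_sq, hx, sum_inner]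
    refine Finset.sum_congr rfl fun j _ => ?_
    rw [inner_sum, Finset.sum_eq_single j]
    · rw [inner_smul_left, inner_smul_right, real_inner_self_eq_norm_sq, hv]
      simp only [conj_trivial]
      ring
    · intro i _ hij
      rw [inner_smul_left, inner_smul_right, ho _ _ hij.symm]
      simp
    · simp
  rw [h1, mul_pow, ← v.sum_sq_inner_right x, mul_comm, Finset.sum_mul]
  gcongr with j _
  · exact singularValue_nonneg _ _
  · exact LinearMap.singularValues_antitone _ (Nat.zero_le _)

theorem singularValue_of_le (M : Matrix (Fin a) (Fin b) ℝ) {j : ℕ} (hj : b ≤ j) :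
    singularValue M j = 0 :=
  LinearMap.singularValues_of_finrank_le _ (by rwa [finrank_euclideanSpace_fin])

/-- If the `r` largest singular values are at least `α`, then the squared Frobenius norm is at least
`r * α ^ 2`. -/
theorem mul_sq_le_frobNorm_sq (M : Matrix (Fin a) (Fin b) ℝ) {r : ℕ} {α : ℝ} (hα : 0 < α)
    (h : ∀ j < r, α ≤ singularValue M j) : r * α ^ 2 ≤ frobNorm M ^ 2 := by
  -- Singular values past the number of columns vanish, and α > 0.
  have hr : r ≤ b := by
    by_contra! hlt
    have := h b hlt
    rw [singularValue_of_le M le_rfl] at this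
    linarith
  rw [sum_sq_singularValue, Fin.sum_univ_eq_sum_range (fun j => singularValue M j ^ 2)]
  calc (r : ℝ) * α ^ 2 = ∑ j ∈ Finset.range r, α ^ 2 := by simp
    _ ≤ ∑ j ∈ Finset.range r, singularValue M j ^ 2 := by
        gcongr with j hj
        exact h j (Finset.mem_range.1 hj)
    _ ≤ _ := Finset.sum_le_sum_of_subset_of_nonneg (Finset.range_mono hr) fun _ _ _ => sq_nonneg _

theorem nuclearNorm_nonneg (M : Matrix (Fin a) (Fin b) ℝ) : 0 ≤ nuclearNorm M :=
  Finset.sum_nonneg fun _ _ => singularValue_nonneg _ _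

end LinearAlgebra

/-! ### Closed form of the gradient along gradient descent -/

section GradientDescent

variable {m k n : ℕ}

/-- On a coordinate line the loss is a sum of squares of affine functions of the parameter, and only
row i depends on it. -/
theorem matrixGradient_loss (A Abar : Matrix (Fin k) (Fin n) ℝ)
    (Wbar W : Matrix (Fin m) (Fin k) ℝ) :
    matrixGradient (loss A Abar Wbar) W = W * gram A - Wbar * crossGram A Abar := by
  ext i j
  have hcurve : ∀ s : ℝ, loss A Abar Wbar (W + s • Matrix.single i j 1) =
      1 / (2 * (n : ℝ)) * ∑ x, ∑ y, ((W * A - Wbar * Abar) x y +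
        s * (if x = i then A j y else 0)) ^ 2 := by
    intro s
    rw [loss, frobNorm_sq]
    congr 1
    refine Finset.sum_congr rfl fun x _ => Finset.sum_congr rfl fun y _ => ?_
    have : (Matrix.single i j (1 : ℝ) * A) x y = if x = i then A j y else 0 := by
      split_ifs with h
      · subst h
        simp
      · simp [h]
    rw [Matrix.add_mul, Matrix.smul_mul, ← this]
    simp only [Matrix.sub_apply, Matrix.add_apply, Matrix.smul_apply, smul_eq_mul]
    ring
  have hder : HasDerivAt (fun s : ℝ => loss A Abar Wbar (W + s • Matrix.single i j 1))
      (1 / (2 * (n : ℝ)) * ∑ x, ∑ y, (2 * ((W * A - Wbar * Abar) x y) *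
        (if x = i then A j y else 0))) 0 := by
    simp_rw [hcurve]
    refine HasDerivAt.const_mul _ (HasDerivAt.fun_sum fun x _ => HasDerivAt.fun_sum fun y _ => ?_)
    have h1 : HasDerivAt (fun s : ℝ => (W * A - Wbar * Abar) x y +
        s * (if x = i then A j y else 0)) (if x = i then A j y else 0) 0 := by
      simpa using ((hasDerivAt_id (0 : ℝ)).mul_const (if x = i then A j y else 0)).const_add
        ((W * A - Wbar * Abar) x y)
    simpa using h1.fun_pow 2
  rw [matrixGradient, Matrix.of_apply, lineDeriv, hder.deriv]
  have h3 : W * gram A - Wbar * crossGram A Abar =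
      (1 / (n : ℝ)) • ((W * A - Wbar * Abar) * Aᵀ) := by
    simp only [gram, crossGram, Matrix.mul_smul, Matrix.sub_mul, smul_sub, Matrix.mul_assoc]
  rw [h3, Matrix.smul_apply, Matrix.mul_apply, smul_eq_mul,
    Finset.sum_eq_single i (fun x _ hx => by simp [hx]) (by simp)]
  simp only [if_true, Matrix.transpose_apply, Finset.mul_sum]
  refine Finset.sum_congr rfl fun y _ => ?_
  field_simp

/-- The gradient along gradient descent started at zero is `-(W̄ B̄) (1 - η B) ^ t`. -/
theorem matrixGradient_gdIterate (A Abar : Matrix (Fin k) (Fin n) ℝ)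
    (Wbar : Matrix (Fin m) (Fin k) ℝ) (η : ℝ) (t : ℕ) :
    matrixGradient (loss A Abar Wbar) (gdIterate A Abar Wbar η t) =
      -(Wbar * (crossGram A Abar * (1 - η • gram A) ^ t)) := by
  induction t with
  | zero => simp [matrixGradient_loss, gdIterate]
  | succ t ih =>
    -- The gradient is affine in W with linear part W ↦ W B, so a step multiplies it on the right by
    -- 1 - ηB.
    rw [gdIterate, ih, matrixGradient_loss, Matrix.sub_mul, sub_right_comm, ← matrixGradient_loss,
      ih, pow_succ]
    simp only [Matrix.mul_sub, Matrix.mul_one, Matrix.mul_smul, Matrix.smul_mul, Matrix.neg_mul,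
      Matrix.mul_assoc, smul_neg]
    abel

end GradientDescent

/-! ### Eigenvalue counting for a spiked matrix -/

section Spectrum

/-- If a quadratic form is at least `α` on a subspace, then at least as many of its eigenvalues
as the dimension of the subspace are at least `α`. -/
theorem finrank_le_card_eigenvalue_ge {E ι : Type*} [NormedAddCommGroup E] [InnerProductSpace ℝ E]
    [FiniteDimensional ℝ E] [Fintype ι] (e : OrthonormalBasis ι ℝ E) (ev : ι → ℝ) (α : ℝ)
    (S : Submodule ℝ E) (hS : ∀ x ∈ S, α * ‖x‖ ^ 2 ≤ ∑ i, ev i * inner ℝ (e i) x ^ 2) :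
    Module.finrank ℝ S ≤ (Finset.univ.filter fun i => α ≤ ev i).card := by
  classical
  by_contra! hlt
  -- If the eigenvalues ≥ α were too few, some nonzero x in S would be orthogonal to all their
  -- eigenvectors. The form at x is then both at most and at least α‖x‖², and termwise equality
  -- forces x = 0.
  let f : S →ₗ[ℝ] ({i // α ≤ ev i} → ℝ) :=
    LinearMap.pi fun i => (innerₗ E (e i)).comp S.subtype
  have hker : LinearMap.ker f ≠ ⊥ := by
    apply LinearMap.ker_ne_bot_of_finrank_lt
    rwa [Module.finrank_fintype_fun_eq_card, Fintype.card_subtype]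
  obtain ⟨x, hx, hx0⟩ := Submodule.exists_mem_ne_zero_of_ne_bot hker
  have hz : ∀ i, α ≤ ev i → inner ℝ (e i) (x : E) = 0 := fun i hi =>
    congrFun (LinearMap.mem_ker.1 hx) ⟨i, hi⟩
  have h1 := hS x x.2
  rw [← e.sum_sq_inner_right, Finset.mul_sum] at h1
  have h2 : ∀ i ∈ Finset.univ, ev i * inner ℝ (e i) (x : E) ^ 2 ≤ α * inner ℝ (e i) (x : E) ^ 2 := by
    intro i _
    by_cases hi : α ≤ ev i
    · simp [hz i hi]
    · exact mul_le_mul_of_nonneg_right (not_le.1 hi).le (sq_nonneg _)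
  have h3 := (Finset.sum_eq_sum_iff_of_le h2).1 (le_antisymm (Finset.sum_le_sum h2) h1)
  refine hx0 (Subtype.ext (e.toBasis.ext_elem_iff.2 fun i => ?_))
  have : inner ℝ (e i) (x : E) = 0 := by
    by_cases hi : α ≤ ev i
    · exact hz i hi
    · have := h3 i (Finset.mem_univ i)
      have h4 : (α - ev i) * inner ℝ (e i) (x : E) ^ 2 = 0 := by linarith
      rcases mul_eq_zero.1 h4 with h | h
      · exact absurd (by linarith) hi
      · exact pow_eq_zero_iff two_ne_zero |>.1 h
  simpa [OrthonormalBasis.repr_apply_apply] using this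

variable {k p : ℕ}

theorem toEuclideanLin_eq_sum (M : Matrix (Fin k) (Fin k) ℝ)
    (e : OrthonormalBasis (Fin k) ℝ (EuclideanSpace ℝ (Fin k))) (g : Fin k → ℝ)
    (h : ∀ i, Matrix.toEuclideanLin M (e i) = g i • e i) (x : EuclideanSpace ℝ (Fin k)) :
    Matrix.toEuclideanLin M x = ∑ i, (g i * inner ℝ (e i) x) • e i := by
  conv_lhs => rw [← e.sum_repr' x]
  simp only [map_sum, map_smul, h, smul_smul]
  simp only [mul_comm]

theorem norm_le_of_eigenbasis (M : Matrix (Fin k) (Fin k) ℝ)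
    (e : OrthonormalBasis (Fin k) ℝ (EuclideanSpace ℝ (Fin k))) (g : Fin k → ℝ)
    (h : ∀ i, Matrix.toEuclideanLin M (e i) = g i • e i) {K : ℝ} (hK : 0 ≤ K)
    (hg : ∀ i, |g i| ≤ K) : ‖M‖ ≤ K := by
  refine norm_le_of_toEuclideanLin M hK fun x => ?_
  refine le_of_sq_le_sq ?_ (by positivity)
  rw [← e.sum_sq_inner_right, mul_pow, ← e.sum_sq_inner_right x, Finset.mul_sum,
    toEuclideanLin_eq_sum M e g h]
  refine Finset.sum_le_sum fun i _ => ?_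
  rw [e.orthonormal.inner_right_fintype, mul_pow]
  refine mul_le_mul_of_nonneg_right ?_ (sq_nonneg _)
  exact sq_le_sq' (by linarith [abs_le.1 (hg i)]) (abs_le.1 (hg i)).2

theorem inner_toEuclideanLin_eq_sum (M : Matrix (Fin k) (Fin k) ℝ)
    (e : OrthonormalBasis (Fin k) ℝ (EuclideanSpace ℝ (Fin k))) (g : Fin k → ℝ)
    (h : ∀ i, Matrix.toEuclideanLin M (e i) = g i • e i) (x : EuclideanSpace ℝ (Fin k)) :
    inner ℝ x (Matrix.toEuclideanLin M x) = ∑ i, g i * inner ℝ (e i) x ^ 2 := by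
  rw [toEuclideanLin_eq_sum M e g h, inner_sum]
  refine Finset.sum_congr rfl fun i _ => ?_
  rw [inner_smul_right, real_inner_comm]
  ring

theorem exists_eigenbasis {M : Matrix (Fin k) (Fin k) ℝ} (hM : M.IsHermitian) :
    ∃ (e : OrthonormalBasis (Fin k) ℝ (EuclideanSpace ℝ (Fin k))) (g : Fin k → ℝ),
      ∀ i, Matrix.toEuclideanLin M (e i) = g i • e i := by
  refine ⟨hM.eigenvectorBasis, hM.eigenvalues, fun i => ?_⟩
  ext j
  simpa [Matrix.toLpLin_apply] using congrFun (hM.mulVec_eigenvectorBasis i) j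

theorem inner_toEuclideanLin_nonneg {M : Matrix (Fin k) (Fin k) ℝ} (hM : M.PosSemidef)
    (x : EuclideanSpace ℝ (Fin k)) : 0 ≤ inner ℝ x (Matrix.toEuclideanLin M x) := by
  have := hM.dotProduct_mulVec_nonneg x.ofLp
  simpa [Matrix.toLpLin_apply, EuclideanSpace.inner_eq_star_dotProduct, dotProduct_comm] using this

theorem toEuclideanLin_sub_smul_one (M : Matrix (Fin k) (Fin k) ℝ) (α : ℝ)
    (x : EuclideanSpace ℝ (Fin k)) : Matrix.toEuclideanLin (M - α • 1) x =
      Matrix.toEuclideanLin M x - α • x := by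
  ext j
  simp [Matrix.toLpLin_apply]

theorem le_inner_of_posSemidef {M : Matrix (Fin k) (Fin k) ℝ} {α : ℝ}
    (hM : (M - α • (1 : Matrix (Fin k) (Fin k) ℝ)).PosSemidef) (x : EuclideanSpace ℝ (Fin k)) :
    α * ‖x‖ ^ 2 ≤ inner ℝ x (Matrix.toEuclideanLin M x) := by
  have := inner_toEuclideanLin_nonneg hM x
  rw [toEuclideanLin_sub_smul_one, inner_sub_right, inner_smul_right,
    real_inner_self_eq_norm_sq] at this
  linarith

theorem inner_le_of_posSemidef {M : Matrix (Fin k) (Fin k) ℝ} {β : ℝ}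
    (hM : (β • (1 : Matrix (Fin k) (Fin k) ℝ) - M).PosSemidef) (x : EuclideanSpace ℝ (Fin k)) :
    inner ℝ x (Matrix.toEuclideanLin M x) ≤ β * ‖x‖ ^ 2 := by
  have := inner_toEuclideanLin_nonneg hM x
  rw [← neg_sub, map_neg, LinearMap.neg_apply, toEuclideanLin_sub_smul_one, inner_neg_right,
    inner_sub_right, inner_smul_right, real_inner_self_eq_norm_sq] at this
  linarith

theorem norm_le_of_posSemidef {M : Matrix (Fin k) (Fin k) ℝ} {α β : ℝ} (hα : 0 ≤ α) (hαβ : α ≤ β)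
    (h₁ : (M - α • (1 : Matrix (Fin k) (Fin k) ℝ)).PosSemidef)
    (h₂ : (β • (1 : Matrix (Fin k) (Fin k) ℝ) - M).PosSemidef) : ‖M‖ ≤ β := by
  have hM : M.IsHermitian := by
    have := h₁.isHermitian.add (Matrix.isHermitian_one.smul (k := α) (by simp [IsSelfAdjoint]))
    simpa using this
  obtain ⟨e, g, h⟩ := exists_eigenbasis hM
  refine norm_le_of_eigenbasis M e g h (hα.trans hαβ) fun i => ?_
  have h3 : inner ℝ (e i) (Matrix.toEuclideanLin M (e i)) = g i := by
    rw [h, inner_smul_right, real_inner_self_eq_norm_sq, e.norm_eq_one]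
    simp
  have h4 := le_inner_of_posSemidef h₁ (e i)
  have h5 := inner_le_of_posSemidef h₂ (e i)
  rw [h3, e.norm_eq_one] at h4 h5
  rw [abs_le]
  constructor <;> linarith

theorem norm_toEuclideanLin_of_isometry {a b : ℕ} {U : Matrix (Fin a) (Fin b) ℝ}
    (hU : Uᵀ * U = 1) (y : EuclideanSpace ℝ (Fin b)) : ‖Matrix.toEuclideanLin U y‖ = ‖y‖ := by
  rw [← sq_eq_sq₀ (norm_nonneg _) (norm_nonneg _), ← real_inner_self_eq_norm_sq,
    ← LinearMap.adjoint_inner_right, ← toEuclideanLin_transpose, ← toEuclideanLin_mul, hU,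
    ← real_inner_self_eq_norm_sq]
  simp

theorem norm_le_one_of_isometry {a b : ℕ} {U : Matrix (Fin a) (Fin b) ℝ} (hU : Uᵀ * U = 1) :
    ‖U‖ ≤ 1 :=
  norm_le_of_toEuclideanLin U zero_le_one fun x => by
    rw [norm_toEuclideanLin_of_isometry hU, one_mul]

theorem inner_spike (U : Matrix (Fin k) (Fin p) ℝ) (q : Fin p → ℝ)
    (x : EuclideanSpace ℝ (Fin k)) :
    inner ℝ x (Matrix.toEuclideanLin (U * Matrix.diagonal q * Uᵀ) x) =
      ∑ i, q i * (Matrix.toEuclideanLin Uᵀ x i) ^ 2 := by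
  rw [Matrix.mul_assoc, toEuclideanLin_mul, ← LinearMap.adjoint_inner_left,
    ← toEuclideanLin_transpose, toEuclideanLin_mul]
  simp only [Matrix.toLpLin_apply, PiLp.inner_apply, Matrix.mulVec_diagonal]
  refine Finset.sum_congr rfl fun i _ => ?_
  simp
  ring

/-- Spectrum of a spiked matrix: every eigenvalue is at most `β` (bulk) or at least `α` (spike), and
there are at most `p` of the latter. -/
theorem spiked_eigenvalues {U : Matrix (Fin k) (Fin p) ℝ} {q : Fin p → ℝ}
    {Γ B : Matrix (Fin k) (Fin k) ℝ} {α β : ℝ} (hU : Uᵀ * U = 1)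
    (hB : B = U * Matrix.diagonal q * Uᵀ + Γ) (hq : ∀ i, α ≤ q i) (hΓ : Γ.PosSemidef)
    (hΓβ : (β • (1 : Matrix (Fin k) (Fin k) ℝ) - Γ).PosSemidef) (hαβ : β < α)
    (e : OrthonormalBasis (Fin k) ℝ (EuclideanSpace ℝ (Fin k))) (ev : Fin k → ℝ)
    (he : ∀ i, Matrix.toEuclideanLin B (e i) = ev i • e i) :
    (∀ i, ev i ≤ β ∨ α ≤ ev i) ∧ (Finset.univ.filter fun i => β < ev i).card ≤ p := by
  classical
  have hform : ∀ x, ∑ i, ev i * inner ℝ (e i) x ^ 2 =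
      ∑ i, q i * (Matrix.toEuclideanLin Uᵀ x i) ^ 2 + inner ℝ x (Matrix.toEuclideanLin Γ x) := by
    intro x
    rw [← inner_toEuclideanLin_eq_sum B e ev he, hB, map_add, LinearMap.add_apply, inner_add_right,
      inner_spike]
  have hinj : Function.Injective (Matrix.toEuclideanLin U) := by
    rw [injective_iff_map_eq_zero]
    intro y hy
    rw [← norm_eq_zero, ← norm_toEuclideanLin_of_isometry hU, hy, norm_zero]
  have hrange : Module.finrank ℝ (LinearMap.range (Matrix.toEuclideanLin U)) = p := by
    rw [LinearMap.finrank_range_of_inj hinj, finrank_euclideanSpace_fin]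
  -- The form is at least α on the range of U, of dimension p, and at most β on the kernel of Uᵀ, of
  -- dimension at least k - p.
  have h1 : p ≤ (Finset.univ.filter fun i => α ≤ ev i).card := by
    rw [← hrange]
    refine finrank_le_card_eigenvalue_ge e ev α _ ?_
    rintro _ ⟨y, rfl⟩
    rw [hform, norm_toEuclideanLin_of_isometry hU, ← toEuclideanLin_mul, hU,
      EuclideanSpace.real_norm_sq_eq, Finset.mul_sum]
    refine le_add_of_le_of_nonneg (Finset.sum_le_sum fun i _ => ?_) (inner_toEuclideanLin_nonneg hΓ _)
    simp only [Matrix.toLpLin_apply, Matrix.one_mulVec]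
    exact mul_le_mul_of_nonneg_right (hq i) (sq_nonneg _)
  have h2 : k - p ≤ (Finset.univ.filter fun i => -β ≤ -ev i).card := by
    have hker : k - p ≤ Module.finrank ℝ (LinearMap.ker (Matrix.toEuclideanLin Uᵀ)) := by
      have h3 := LinearMap.finrank_range_add_finrank_ker (Matrix.toEuclideanLin Uᵀ)
      have h4 := Submodule.finrank_le (LinearMap.range (Matrix.toEuclideanLin Uᵀ))
      rw [finrank_euclideanSpace_fin] at h3 h4
      omega
    refine hker.trans (finrank_le_card_eigenvalue_ge e (fun i => -ev i) (-β) _ ?_)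
    intro x hx
    simp only [neg_mul, Finset.sum_neg_distrib, hform, LinearMap.mem_ker.1 hx]
    have := inner_le_of_posSemidef hΓβ x
    simpa using this
  simp only [neg_le_neg_iff] at h2
  have hpk : p ≤ k := by
    have := Submodule.finrank_le (LinearMap.range (Matrix.toEuclideanLin U))
    rwa [hrange, finrank_euclideanSpace_fin] at this
  have hdisj : Disjoint (Finset.univ.filter fun i => α ≤ ev i)
      (Finset.univ.filter fun i => ev i ≤ β) := by
    rw [Finset.disjoint_filter]
    intro i _ h h'
    linarith
  -- The two disjoint groups already have k members together, so no eigenvalue lies strictly between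
  -- β and α.
  have hunion : (Finset.univ.filter fun i => α ≤ ev i) ∪ (Finset.univ.filter fun i => ev i ≤ β) =
      Finset.univ := by
    apply Finset.eq_univ_of_card
    refine le_antisymm (Finset.card_le_univ _) ?_
    rw [Finset.card_union_of_disjoint hdisj, Fintype.card_fin]
    omega
  refine ⟨fun i => ?_, ?_⟩
  · have := hunion ▸ Finset.mem_univ i
    simp only [Finset.mem_union, Finset.mem_filter, Finset.mem_univ, true_and] at this
    exact this.symm
  · have h3 := Finset.card_filter_add_card_filter_not (s := (Finset.univ : Finset (Fin k)))
      (fun i => ev i ≤ β)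
    simp only [not_le, Finset.card_univ, Fintype.card_fin] at h3
    omega

end Spectrum

/-! ### Damping of spikes and survival of the bulk -/

section Filter

/-- The spike part of the spectrum is damped after `2 c c₂ / c₁ * d ^ (u - ℓ) * log d` steps. -/
theorem mul_one_sub_pow_le {d c₁ c₂ ℓ u c N x : ℝ} {t : ℕ} (hc₁ : 0 < c₁) (hc₁₂ : c₁ ≤ c₂)
    (hu : u ≤ 1) (hc : 1 ≤ c) (hd : 1 ≤ d) (hN : 0 < N) (hN₂ : N ≤ 2 * c₂ * d ^ u) (hxN : x ≤ N)
    (hx : c₁ * d ^ ℓ ≤ x) (ht : 2 * c * c₂ / c₁ * d ^ (u - ℓ) * Real.log d ≤ t) :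
    x * (1 - 1 / (c * N) * x) ^ t ≤ 2 * c₂ := by
  have hd0 : 0 < d := by linarith
  have hc₂ : 0 < c₂ := hc₁.trans_le hc₁₂
  have hx0 : 0 < x := lt_of_lt_of_le (by positivity) hx
  have hle : 1 / (c * N) * x ≤ 1 := by
    rw [one_div, inv_mul_le_iff₀ (by positivity)]
    nlinarith
  have h1 : (1 - 1 / (c * N) * x) ^ t ≤ Real.exp (-Real.log d) := by
    calc (1 - 1 / (c * N) * x) ^ t ≤ Real.exp (-(1 / (c * N) * x)) ^ t :=
          pow_le_pow_left₀ (by linarith) (Real.one_sub_le_exp_neg _) t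
      _ = Real.exp (-(t * (1 / (c * N) * x))) := by rw [← Real.exp_nat_mul]; ring_nf
      _ ≤ _ := by
          rw [Real.exp_le_exp, neg_le_neg_iff]
          have hlog : 0 ≤ Real.log d := Real.log_nonneg hd
          -- The start of the window times the smallest possible η x is exactly log d; this dictates
          -- the constant C₁. The resulting factor 1/d absorbs x ≤ 2c₂ d^u because u ≤ 1.
          calc Real.log d = (2 * c * c₂ / c₁ * d ^ (u - ℓ) * Real.log d) *
                (1 / (c * (2 * c₂ * d ^ u)) * (c₁ * d ^ ℓ)) := by
                rw [Real.rpow_sub hd0]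
                field_simp
            _ ≤ t * (1 / (c * N) * x) := by gcongr
  rw [Real.exp_neg, Real.exp_log hd0] at h1
  calc x * (1 - 1 / (c * N) * x) ^ t ≤ (2 * c₂ * d ^ u) * d⁻¹ := by
        gcongr
        exact hxN.trans hN₂
    _ ≤ (2 * c₂ * d ^ (1 : ℝ)) * d⁻¹ := by gcongr
    _ = 2 * c₂ := by rw [Real.rpow_one]; field_simp

/-- The bulk part of the spectrum is not damped during `C₃ d ^ u` steps. -/
theorem exp_le_one_sub_pow {d c₁ c₂ u c C₃ N x : ℝ} {t : ℕ} (hc₁ : 0 < c₁)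
    (hc : 1 ≤ c) (hd : 1 ≤ d) (hN : c₁ * d ^ u ≤ N) (hx0 : 0 ≤ x) (hx : x ≤ c₂)
    (hstep : c₂ / (c₁ * d ^ u) ≤ 1 / 2) (ht : t ≤ C₃ * d ^ u) :
    Real.exp (-(2 * C₃ * c₂ / (c * c₁))) ≤ (1 - 1 / (c * N) * x) ^ t := by
  have hd0 : 0 < d := by linarith
  have hN0 : 0 < N := lt_of_lt_of_le (by positivity) hN
  set y := 1 / (c * N) * x with hy
  have hy0 : 0 ≤ y := by positivity
  have hy1 : y ≤ c₂ / (c * (c₁ * d ^ u)) := by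
    rw [hy, one_div, inv_mul_eq_div]
    have : 0 ≤ c₂ := hx0.trans hx
    gcongr
  have hy2 : y ≤ 1 / 2 := by
    refine hy1.trans (le_trans ?_ hstep)
    have : 0 ≤ c₂ := hx0.trans hx
    apply div_le_div_of_nonneg_left this (by positivity)
    exact le_mul_of_one_le_left (by positivity) hc
  -- On [0, 1/2]: 1/(1 - y) = 1 + y/(1 - y) ≤ exp(y/(1 - y)) ≤ exp(2y).
  have h1 : Real.exp (-(2 * y)) ≤ 1 - y := by
    have h2 : 1 + y / (1 - y) ≤ Real.exp (y / (1 - y)) := by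
      linarith [Real.add_one_le_exp (y / (1 - y))]
    have h3 : y / (1 - y) ≤ 2 * y := by
      rw [div_le_iff₀ (by linarith)]
      nlinarith
    have h4 : 1 + y / (1 - y) = (1 - y)⁻¹ := by
      have : 1 - y ≠ 0 := by linarith
      field_simp
      ring
    rw [Real.exp_neg, inv_le_comm₀ (Real.exp_pos _) (by linarith), ← h4]
    exact h2.trans (Real.exp_le_exp.2 h3)
  calc Real.exp (-(2 * C₃ * c₂ / (c * c₁))) ≤ Real.exp (-(2 * y)) ^ t := by
        rw [← Real.exp_nat_mul, Real.exp_le_exp, mul_neg, neg_le_neg_iff]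
        have hCd : 0 ≤ C₃ * d ^ u := (Nat.cast_nonneg t).trans ht
        calc (t : ℝ) * (2 * y) ≤ (C₃ * d ^ u) * (2 * (c₂ / (c * (c₁ * d ^ u)))) := by gcongr
          _ = _ := by field_simp
    _ ≤ _ := by gcongr

end Filter

/-! ### Deterministic consequences of the model in the time window -/

section Structure

variable {k n p : ℕ}

theorem toEuclideanLin_pow_eigenvector (B : Matrix (Fin k) (Fin k) ℝ) (η ev : ℝ)
    (x : EuclideanSpace ℝ (Fin k)) (hx : Matrix.toEuclideanLin B x = ev • x) (t : ℕ) :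
    Matrix.toEuclideanLin ((1 - η • B) ^ t) x = (1 - η * ev) ^ t • x := by
  induction t with
  | zero => simp
  | succ t ih =>
    rw [pow_succ, toEuclideanLin_mul, map_sub, map_smul, LinearMap.sub_apply, LinearMap.smul_apply,
      hx]
    have : Matrix.toEuclideanLin (1 : Matrix (Fin k) (Fin k) ℝ) x = x := by simp
    rw [this, map_sub, map_smul, map_smul, ih, pow_succ, smul_smul, smul_smul, ← sub_smul]
    congr 1
    ring

theorem exists_matrix_eigenbasis (e : OrthonormalBasis (Fin k) ℝ (EuclideanSpace ℝ (Fin k)))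
    (g : Fin k → ℝ) : ∃ R : Matrix (Fin k) (Fin k) ℝ,
      ∀ i, Matrix.toEuclideanLin R (e i) = g i • e i := by
  refine ⟨Matrix.toEuclideanLin.symm (e.toBasis.constr ℝ fun i => g i • e i), fun i => ?_⟩
  rw [LinearEquiv.apply_symm_apply]
  simp

theorem opNorm_eq (M : Matrix (Fin k) (Fin k) ℝ) : opNorm M = ‖M‖ := rfl

theorem abs_eigenvalue_le_norm (B : Matrix (Fin k) (Fin k) ℝ) (ev : ℝ)
    (x : EuclideanSpace ℝ (Fin k)) (hx1 : ‖x‖ = 1) (hx : Matrix.toEuclideanLin B x = ev • x) :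
    |ev| ≤ ‖B‖ := by
  have := norm_toEuclideanLin_apply_le B x
  rwa [hx, norm_smul, hx1, mul_one, mul_one] at this

theorem isHermitian_gram (A : Matrix (Fin k) (Fin n) ℝ) : (gram A).IsHermitian := by
  rw [Matrix.IsHermitian, Matrix.conjTranspose_eq_transpose_of_trivial, gram]
  simp

theorem norm_spike_le {U V : Matrix (Fin k) (Fin p) ℝ} (hU : Uᵀ * U = 1) (hV : Vᵀ * V = 1)
    {q : Fin p → ℝ} {K : ℝ} (hK : 0 ≤ K) (hq : ∀ i, |q i| ≤ K) :
    ‖V * Matrix.diagonal q * Uᵀ‖ ≤ K := by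
  refine (Matrix.l2_opNorm_mul _ _).trans ?_
  have h1 : ‖Uᵀ‖ ≤ 1 := (norm_transpose U).trans_le (norm_le_one_of_isometry hU)
  have h2 := norm_le_one_of_isometry hV
  have h3 : ‖Matrix.diagonal q‖ ≤ K := by
    rw [Matrix.l2_opNorm_diagonal]
    exact (pi_norm_le_iff_of_nonneg hK).2 hq
  calc ‖V * Matrix.diagonal q‖ * ‖Uᵀ‖ ≤ ‖V * Matrix.diagonal q‖ * 1 := by gcongr
    _ ≤ (‖V‖ * ‖Matrix.diagonal q‖) * 1 := by gcongr; exact Matrix.l2_opNorm_mul _ _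
    _ ≤ (1 * K) * 1 := by gcongr
    _ = K := by ring

/-- A spike direction is damped as soon as `B P` is bounded. -/
theorem norm_spike_mul_le {U : Matrix (Fin k) (Fin p) ℝ} {q : Fin p → ℝ}
    {Γ B P : Matrix (Fin k) (Fin k) ℝ} {α β K : ℝ} (hα : 0 < α) (hU : Uᵀ * U = 1)
    (hB : B = U * Matrix.diagonal q * Uᵀ + Γ) (hq : ∀ i, α ≤ q i) (hΓ : ‖Γ‖ ≤ β) (hP : ‖P‖ ≤ 1)
    (hBP : ‖B * P‖ ≤ K) : ‖Uᵀ * P‖ ≤ α⁻¹ * (K + β) := by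
  have hUt : ‖Uᵀ‖ ≤ 1 := (norm_transpose U).trans_le (norm_le_one_of_isometry hU)
  -- Solving (B - Γ)P = U Q UᵀP for UᵀP gains the factor Q⁻¹ and avoids any comparison of U with the
  -- eigenvectors of B.
  have h1 : Uᵀ * P = Matrix.diagonal (fun i => (q i)⁻¹) * (Uᵀ * (B * P - Γ * P)) := by
    have h2 : B * P - Γ * P = U * (Matrix.diagonal q * (Uᵀ * P)) := by
      rw [← Matrix.sub_mul, hB, add_sub_cancel_right]
      simp only [Matrix.mul_assoc]
    rw [h2, ← Matrix.mul_assoc Uᵀ U, hU, Matrix.one_mul, ← Matrix.mul_assoc,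
      Matrix.diagonal_mul_diagonal]
    have h3 : (fun i => (q i)⁻¹ * q i) = fun _ => (1 : ℝ) := by
      ext i
      exact inv_mul_cancel₀ (hα.trans_le (hq i)).ne'
    rw [h3, Matrix.diagonal_one, Matrix.one_mul]
  have h4 : ‖Matrix.diagonal (fun i => (q i)⁻¹)‖ ≤ α⁻¹ := by
    rw [Matrix.l2_opNorm_diagonal]
    refine (pi_norm_le_iff_of_nonneg (by positivity)).2 fun i => ?_
    rw [norm_inv, Real.norm_of_nonneg (hα.le.trans (hq i))]
    exact inv_anti₀ hα (hq i)
  have h5 : ‖Γ * P‖ ≤ β := by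
    refine (Matrix.l2_opNorm_mul _ _).trans ?_
    calc ‖Γ‖ * ‖P‖ ≤ ‖Γ‖ * 1 := by gcongr
      _ ≤ β := by rwa [mul_one]
  have h6 : ‖B * P - Γ * P‖ ≤ K + β := (norm_sub_le _ _).trans (add_le_add hBP h5)
  have h7 : ‖Uᵀ * (B * P - Γ * P)‖ ≤ K + β := by
    refine (Matrix.l2_opNorm_mul _ _).trans ?_
    calc ‖Uᵀ‖ * ‖B * P - Γ * P‖ ≤ 1 * ‖B * P - Γ * P‖ := by gcongr
      _ ≤ K + β := by rwa [one_mul]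
  rw [h1]
  refine (Matrix.l2_opNorm_mul _ _).trans ?_
  gcongr

/-- The deterministic consequences of the multi-spiked model for the gradient descent filter
`P = (1 - η B) ^ t` in the time window. -/
theorem MultiSpiked.exists_structure {d r : ℕ} {c₁ c₂ ℓ u c C₃ : ℝ}
    (hc₁ : 0 < c₁) (hc₁₂ : c₁ ≤ c₂) (hu0 : 0 ≤ u) (hu : u ≤ 1) (hc : 1 ≤ c)
    (hd : 1 ≤ d) (hr : 0 < r) (hsep : c₂ < c₁ * (d : ℝ) ^ ℓ)
    (hstep : c₂ / (c₁ * (d : ℝ) ^ u) ≤ 1 / 2) {A Abar : Matrix (Fin k) (Fin n) ℝ}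
    (h : MultiSpiked d p r c₁ c₂ ℓ u A Abar) :
    ∃ (D : Submodule ℝ (EuclideanSpace ℝ (Fin k))) (V : Matrix (Fin k) (Fin p) ℝ)
      (S : Matrix (Fin k) (Fin k) ℝ), Module.finrank ℝ D ≤ 2 * p ∧ Vᵀ * V = 1 ∧ ‖S‖ ≤ c₂ ∧
      r * c₁ ^ 2 ≤ frobNorm S ^ 2 ∧
      ∀ t : ℕ, 2 * c * c₂ / c₁ * (d : ℝ) ^ (u - ℓ) * Real.log d ≤ t → t ≤ C₃ * (d : ℝ) ^ u →
        (∀ {m : ℕ} (W : Matrix (Fin m) (Fin k) ℝ),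
          frobNorm (W * (crossGram A Abar * (1 - (1 / (c * opNorm (gram A))) • gram A) ^ t)) ^ 2 ≤
            2 * ((3 * c₂ ^ 2 / c₁ * (d : ℝ) ^ (u - ℓ)) ^ 2 * frobNorm (W * V) ^ 2) +
              2 * (c₂ ^ 2 * frobNorm W ^ 2)) ∧
        ∃ R : Matrix (Fin k) (Fin k) ℝ, ‖R‖ ≤ Real.exp (2 * C₃ * c₂ / (c * c₁)) ∧
          ∀ x ∈ Dᗮ, Matrix.toEuclideanLin
            (crossGram A Abar * (1 - (1 / (c * opNorm (gram A))) • gram A) ^ t * R) x =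
              Matrix.toEuclideanLin S x := by
  classical
  obtain ⟨H₁, H₂, Γ, S, U, V, q, qbar, hB, hBbar, hU, hV, -, -, hH₁, hH₂, hq, hqbar, ⟨i₀, hi₀⟩,
    hΓ₁, hΓ₂, hS⟩ := h
  have hd1 : (1 : ℝ) ≤ d := by exact_mod_cast hd
  have hd0 : (0 : ℝ) < d := by linarith
  have hc₂ : 0 < c₂ := hc₁.trans_le hc₁₂
  set B := gram A with hBdef
  set N := ‖B‖ with hNdef
  rw [hH₁] at hB
  have hΓ : ‖Γ‖ ≤ c₂ := norm_le_of_posSemidef hc₁.le hc₁₂ hΓ₁ hΓ₂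
  have hΓpos : Γ.PosSemidef := by
    have := hΓ₁.add (Matrix.PosSemidef.one.smul hc₁.le)
    simpa using this
  have hdu : (1 : ℝ) ≤ (d : ℝ) ^ u := Real.one_le_rpow hd1 hu0
  have hN₂ : N ≤ 2 * c₂ * (d : ℝ) ^ u := by
    rw [hNdef, hB]
    refine (norm_add_le _ _).trans ?_
    have := norm_spike_le hU hU (q := q) (K := c₂ * (d : ℝ) ^ u) (by positivity) (fun i => by
      rw [abs_of_nonneg (le_trans (by positivity) (hq i).1)]
      exact (hq i).2)
    nlinarith
  -- Test the quadratic form of B at the column of U that carries the large entry of Q.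
  have hN₁ : c₁ * (d : ℝ) ^ u ≤ N := by
    set x := Matrix.toEuclideanLin U (EuclideanSpace.single i₀ 1) with hx
    have hx1 : ‖x‖ = 1 := by rw [hx, norm_toEuclideanLin_of_isometry hU]; simp
    have h1 : inner ℝ x (Matrix.toEuclideanLin B x) ≤ N := by
      refine (real_inner_le_norm _ _).trans ?_
      have := norm_toEuclideanLin_apply_le B x
      rw [hx1, one_mul]
      rwa [hx1, mul_one] at this
    refine hi₀.trans (le_trans ?_ h1)
    rw [hB, map_add, LinearMap.add_apply, inner_add_right, inner_spike]
    refine le_add_of_le_of_nonneg ?_ (inner_toEuclideanLin_nonneg hΓpos _)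
    rw [hx, ← toEuclideanLin_mul, hU, Finset.sum_eq_single i₀]
    · simp
    · intro j _ hj
      simp [hj]
    · simp
  have hN0 : 0 < N := lt_of_lt_of_le (by positivity) hN₁
  obtain ⟨e, ev, he⟩ := exists_eigenbasis (isHermitian_gram A)
  obtain ⟨hev, hcard⟩ := spiked_eigenvalues hU hB (fun i => (hq i).1) hΓpos hΓ₂ hsep e ev he
  have hev0 : ∀ i, 0 ≤ ev i := by
    intro i
    have h1 : inner ℝ (e i) (Matrix.toEuclideanLin B (e i)) = ev i := by
      rw [he, inner_smul_right, real_inner_self_eq_norm_sq, e.norm_eq_one]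
      simp
    rw [← h1, hB, map_add, LinearMap.add_apply, inner_add_right, inner_spike]
    refine add_nonneg (Finset.sum_nonneg fun j _ => mul_nonneg ?_ (sq_nonneg _))
      (inner_toEuclideanLin_nonneg hΓpos _)
    exact le_trans (by positivity) (hq j).1
  have hevN : ∀ i, ev i ≤ N := fun i =>
    (le_abs_self _).trans (abs_eigenvalue_le_norm B (ev i) (e i) (e.norm_eq_one i) (he i))
  -- Orthogonality to the range of U kills the spike part of the cross-Gram matrix; orthogonality to
  -- the spike eigenvectors leaves only directions where P can be inverted at bounded cost. D is
  -- fixed before t, which keeps the later random events free of t.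
  let D : Submodule ℝ (EuclideanSpace ℝ (Fin k)) :=
    LinearMap.range (Matrix.toEuclideanLin U) ⊔
      Submodule.span ℝ ((Finset.univ.filter fun i => c₂ < ev i).image e : Finset _)
  refine ⟨D, V, S, ?_, hV, ?_, ?_, ?_⟩
  · refine (Submodule.finrank_add_le_finrank_add_finrank _ _).trans ?_
    have h1 := LinearMap.finrank_range_le (Matrix.toEuclideanLin U)
    have h2 := finrank_span_finset_le_card (R := ℝ)
      ((Finset.univ.filter fun i => c₂ < ev i).image e)
    have h3 := Finset.card_image_le (s := Finset.univ.filter fun i => c₂ < ev i) (f := e)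
    rw [finrank_euclideanSpace_fin] at h1
    rw [Set.finrank] at h2
    omega
  · exact (norm_le_singularValue_zero S).trans (hS 0 hr).2
  · exact mul_sq_le_frobNorm_sq S hc₁ fun j hj => (hS j hj).1
  intro t ht₁ ht₂
  rw [opNorm_eq, ← hNdef]
  set η := 1 / (c * N) with hη
  set P := (1 - η • B) ^ t with hPdef
  have hP : ∀ i, Matrix.toEuclideanLin P (e i) = (1 - η * ev i) ^ t • e i := fun i =>
    toEuclideanLin_pow_eigenvector B η (ev i) (e i) (he i) t
  have hηev : ∀ i, η * ev i ≤ 1 := by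
    intro i
    rw [hη, one_div, inv_mul_le_iff₀ (by positivity)]
    nlinarith [hevN i, hev0 i]
  have hη0 : 0 ≤ η := by positivity
  have hg0 : ∀ i, 0 ≤ (1 - η * ev i) ^ t := fun i => pow_nonneg (by linarith [hηev i]) _
  have hg1 : ∀ i, (1 - η * ev i) ^ t ≤ 1 := fun i =>
    pow_le_one₀ (by linarith [hηev i]) (by linarith [mul_nonneg hη0 (hev0 i)])
  have hPnorm : ‖P‖ ≤ 1 := norm_le_of_eigenbasis P e _ hP zero_le_one fun i => by
    rw [abs_of_nonneg (hg0 i)]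
    exact hg1 i
  have hBP : ‖B * P‖ ≤ 2 * c₂ := by
    refine norm_le_of_eigenbasis (B * P) e (fun i => ev i * (1 - η * ev i) ^ t) (fun i => ?_)
      (by positivity) fun i => ?_
    · rw [toEuclideanLin_mul, hP, map_smul, he, smul_smul, mul_comm]
    · rw [abs_of_nonneg (mul_nonneg (hev0 i) (hg0 i))]
      rcases hev i with hi | hi
      · calc ev i * (1 - η * ev i) ^ t ≤ c₂ * 1 := by
              gcongr
              · exact hg0 i
              · exact hg1 i
          _ ≤ 2 * c₂ := by linarith
      · exact mul_one_sub_pow_le hc₁ hc₁₂ hu hc hd1 hN0 hN₂ (hevN i) hi ht₁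
  refine ⟨fun {m} W => ?_, ?_⟩
  · have hX : ‖Matrix.diagonal qbar * (Uᵀ * P)‖ ≤ 3 * c₂ ^ 2 / c₁ * (d : ℝ) ^ (u - ℓ) := by
      have h1 := norm_spike_mul_le (by positivity) hU hB (fun i => (hq i).1) hΓ hPnorm hBP
      have h2 : ‖Matrix.diagonal qbar‖ ≤ c₂ * (d : ℝ) ^ u := by
        rw [Matrix.l2_opNorm_diagonal]
        refine (pi_norm_le_iff_of_nonneg (by positivity)).2 fun i => ?_
        rw [Real.norm_of_nonneg (le_trans (by positivity) (hqbar i).1)]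
        exact (hqbar i).2
      calc _ ≤ ‖Matrix.diagonal qbar‖ * ‖Uᵀ * P‖ := Matrix.l2_opNorm_mul _ _
        _ ≤ (c₂ * (d : ℝ) ^ u) * ((c₁ * (d : ℝ) ^ ℓ)⁻¹ * (2 * c₂ + c₂)) := by gcongr
        _ = _ := by
          rw [Real.rpow_sub hd0]
          field_simp
          ring
    -- The norm of the spike factor may grow like d^(u-ℓ), but it multiplies W V, which has only p
    -- columns.
    have hsplit : W * (crossGram A Abar * P) =
        (W * V) * (Matrix.diagonal qbar * (Uᵀ * P)) + W * (S * P) := by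
      rw [hBbar, hH₂]
      simp only [Matrix.add_mul, Matrix.mul_add, Matrix.mul_assoc]
    rw [hsplit]
    refine (frobNorm_add_sq_le _ _).trans ?_
    have hSP : ‖S * P‖ ≤ c₂ := by
      calc ‖S * P‖ ≤ ‖S‖ * ‖P‖ := Matrix.l2_opNorm_mul _ _
        _ ≤ c₂ * 1 := by
          gcongr
          exact (norm_le_singularValue_zero S).trans (hS 0 hr).2
        _ = c₂ := mul_one _
    gcongr
    · refine (frobNorm_mul_sq_le _ _).trans ?_
      gcongr
    · refine (frobNorm_mul_sq_le _ _).trans ?_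
      gcongr
  -- R inverts P on bulk eigenvectors and vanishes on spike eigenvectors, where the inverse would be
  -- too large.
  · obtain ⟨R, hR⟩ := exists_matrix_eigenbasis e
      (fun i => if ev i ≤ c₂ then ((1 - η * ev i) ^ t)⁻¹ else 0)
    have hlow : ∀ i, ev i ≤ c₂ →
        Real.exp (-(2 * C₃ * c₂ / (c * c₁))) ≤ (1 - η * ev i) ^ t := fun i hi =>
      exp_le_one_sub_pow hc₁ hc hd1 hN₁ (hev0 i) hi hstep ht₂
    refine ⟨R, norm_le_of_eigenbasis R e _ hR (Real.exp_pos _).le fun i => ?_, fun x hx => ?_⟩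
    · split_ifs with hi
      · rw [abs_of_nonneg (inv_nonneg.2 (hg0 i)), inv_le_comm₀
          (lt_of_lt_of_le (Real.exp_pos _) (hlow i hi)) (Real.exp_pos _), ← Real.exp_neg]
        exact hlow i hi
      · rw [abs_zero]
        exact (Real.exp_pos _).le
    · have hxe : ∀ i, c₂ < ev i → inner ℝ (e i) x = 0 := by
        intro i hi
        refine hx (e i) (Submodule.mem_sup_right (Submodule.subset_span ?_))
        simp only [Finset.coe_image, Finset.coe_filter, Finset.mem_univ, true_and]
        exact ⟨i, hi, rfl⟩
      have hxU : Matrix.toEuclideanLin Uᵀ x = 0 := by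
        rw [← inner_self_eq_zero (𝕜 := ℝ), toEuclideanLin_transpose, LinearMap.adjoint_inner_right]
        exact hx _ (Submodule.mem_sup_left ⟨_, rfl⟩)
      have hPR : Matrix.toEuclideanLin (P * R) x = x := by
        rw [toEuclideanLin_mul, toEuclideanLin_eq_sum R e _ hR, map_sum]
        conv_rhs => rw [← e.sum_repr' x]
        refine Finset.sum_congr rfl fun i _ => ?_
        rw [map_smul, hP, smul_smul]
        congr 1
        by_cases hi : ev i ≤ c₂
        · have := (lt_of_lt_of_le (Real.exp_pos _) (hlow i hi)).ne'
          simp only [hi, if_true]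
          field_simp
        · simp [hxe i (not_le.1 hi)]
      rw [Matrix.mul_assoc, toEuclideanLin_mul, hPR, hBbar, hH₂, map_add, LinearMap.add_apply,
        toEuclideanLin_mul, hxU, map_zero, zero_add]

end Structure

/-! ### Moments and lower tails of Gaussian quadratic forms -/

section Gaussian

/-- The variance of the square of a standard Gaussian variable. -/
noncomputable def chiSqVar : ℝ := Var[fun x : ℝ => x ^ 2; gaussianReal 0 1]

theorem chiSqVar_nonneg : 0 ≤ chiSqVar := variance_nonneg _ _

theorem memLp_sq_gaussianReal : MemLp (fun x : ℝ => x ^ 2) 2 (gaussianReal 0 1) := by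
  have h := memLp_id_gaussianReal' (μ := 0) (v := 1) 4 (by simp)
  have h2 := h.norm_rpow_div 2
  have h3 : (4 : ENNReal) / 2 = 2 := by
    rw [eq_comm, ENNReal.eq_div_iff (by simp) (by simp)]
    norm_num
  rw [h3] at h2
  refine h2.congr_norm (by fun_prop) (ae_of_all _ fun x => ?_)
  simp

theorem integral_sq_gaussianReal : ∫ x : ℝ, x ^ 2 ∂gaussianReal 0 1 = 1 := by
  have h := variance_fun_id_gaussianReal (μ := 0) (v := 1)
  rw [variance_eq_integral (by fun_prop)] at h
  simpa using h

variable {ι : Type*} [Fintype ι]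

theorem memLp_sum_eval {Ω : Type*} [MeasurableSpace Ω] (ρ : Measure Ω) [IsProbabilityMeasure ρ]
    {X : ι → Ω → ℝ} (h : ∀ i, MemLp (X i) 2 ρ) :
    MemLp (∑ i, fun ω : ι → Ω => X i (ω i)) 2 (Measure.pi fun _ => ρ) :=
  memLp_finsetSum' _ fun i _ => (h i).comp_measurePreserving (measurePreserving_eval _ i)

theorem integral_sum_eval {Ω : Type*} [MeasurableSpace Ω] (ρ : Measure Ω) [IsProbabilityMeasure ρ]
    {X : ι → Ω → ℝ} (h : ∀ i, MemLp (X i) 2 ρ) :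
    ∫ ω, (∑ i, fun ω : ι → Ω => X i (ω i)) ω ∂(Measure.pi fun _ => ρ) = ∑ i, ∫ x, X i x ∂ρ := by
  simp only [Finset.sum_apply]
  rw [integral_finsetSum]
  · refine Finset.sum_congr rfl fun i _ => ?_
    exact integral_comp_eval (μ := fun _ : ι => ρ) (h i).aestronglyMeasurable
  · intro i _
    exact integrable_comp_eval (μ := fun _ : ι => ρ) ((h i).integrable one_le_two)

/-- Chebyshev's inequality for a sum of functions of independent coordinates. -/
theorem measure_sum_eval_sub_ge_le {Ω : Type*} [MeasurableSpace Ω] (ρ : Measure Ω)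
    [IsProbabilityMeasure ρ] {X : ι → Ω → ℝ} (h : ∀ i, MemLp (X i) 2 ρ) {s : ℝ} (hs : 0 < s) :
    (Measure.pi fun _ : ι => ρ) {ω | s ≤ |∑ i, X i (ω i) - ∑ i, ∫ x, X i x ∂ρ|} ≤
      ENNReal.ofReal ((∑ i, Var[X i; ρ]) / s ^ 2) := by
  have := meas_ge_le_variance_div_sq (memLp_sum_eval ρ h) hs
  rw [variance_sum_pi h, integral_sum_eval ρ h] at this
  simpa using this

theorem memLp_weighted_sq (w : ℝ) : MemLp (fun x : ℝ => w * x ^ 2) 2 (gaussianReal 0 1) :=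
  memLp_sq_gaussianReal.const_mul _

theorem integral_weighted_sq (w : ℝ) : ∫ x : ℝ, w * x ^ 2 ∂gaussianReal 0 1 = w := by
  rw [integral_const_mul, integral_sq_gaussianReal, mul_one]

theorem variance_weighted_sq (w : ℝ) :
    Var[fun x : ℝ => w * x ^ 2; gaussianReal 0 1] = w ^ 2 * chiSqVar :=
  variance_const_mul _ _ _

variable {E F : Type*} [NormedAddCommGroup E] [InnerProductSpace ℝ E] [FiniteDimensional ℝ E]
  [NormedAddCommGroup F] [InnerProductSpace ℝ F] [FiniteDimensional ℝ F]

/-- The eigenbasis of T*T diagonalizes the form. By rotation invariance a standard Gaussian vector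
has independent standard coordinates there, so its image has squared norm a weighted sum of
independent squares. -/
theorem norm_sq_apply_sum_eigenvector {n : ℕ} (hn : Module.finrank ℝ E = n) (T : E →ₗ[ℝ] F)
    (x : Fin n → ℝ) :
    ‖T (∑ i, x i • T.isSymmetric_adjoint_comp_self.eigenvectorBasis hn i)‖ ^ 2 =
      ∑ i, T.isSymmetric_adjoint_comp_self.eigenvalues hn i * x i ^ 2 := by
  set b := T.isSymmetric_adjoint_comp_self.eigenvectorBasis hn
  rw [← real_inner_self_eq_norm_sq, ← LinearMap.adjoint_inner_right, ← LinearMap.comp_apply,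
    map_sum, sum_inner]
  refine Finset.sum_congr rfl fun i _ => ?_
  simp only [map_smul]
  rw [inner_smul_left]
  have : ∀ j, x j • (LinearMap.adjoint T ∘ₗ T) (b j) =
      (x j * T.isSymmetric_adjoint_comp_self.eigenvalues hn j) • b j := by
    intro j
    rw [LinearMap.IsSymmetric.apply_eigenvectorBasis, smul_smul]
    rfl
  simp_rw [this]
  rw [b.orthonormal.inner_right_fintype]
  simp only [conj_trivial]
  ring

theorem eigenvalue_eq_norm_sq {n : ℕ} (hn : Module.finrank ℝ E = n) (T : E →ₗ[ℝ] F) (i : Fin n) :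
    T.isSymmetric_adjoint_comp_self.eigenvalues hn i =
      ‖T (T.isSymmetric_adjoint_comp_self.eigenvectorBasis hn i)‖ ^ 2 := by
  classical
  have := norm_sq_apply_sum_eigenvector hn T (Pi.single i 1)
  simp only [Pi.single_apply, ite_smul, one_smul, zero_smul, Finset.sum_ite_eq', Finset.mem_univ,
    if_true, ite_pow, one_pow, ne_eq, OfNat.ofNat_ne_zero, not_false_eq_true, zero_pow, mul_ite,
    mul_one, mul_zero] at this
  exact this.symm

variable [MeasurableSpace E] [BorelSpace E]

/-- Chebyshev's lower tail bound for the squared norm of the image of a standard Gaussian vector. -/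
theorem stdGaussian_norm_sq_lt_le {n : ℕ} (hn : Module.finrank ℝ E = n) (T : E →ₗ[ℝ] F) {K h s : ℝ}
    (hK : ∀ x, ‖T x‖ ≤ K * ‖x‖) (b : OrthonormalBasis (Fin n) ℝ E)
    (hT : h ≤ ∑ i, ‖T (b i)‖ ^ 2) (hs : s < h) :
    stdGaussian E {x | ‖T x‖ ^ 2 < s} ≤
      ENNReal.ofReal (n * K ^ 4 * chiSqVar / (h - s) ^ 2) := by
  set e := T.isSymmetric_adjoint_comp_self.eigenvectorBasis hn
  set ev := T.isSymmetric_adjoint_comp_self.eigenvalues hn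
  have hev : ∀ i, ev i = ‖T (e i)‖ ^ 2 := eigenvalue_eq_norm_sq hn T
  have hsum : h ≤ ∑ i, ev i := by
    simp_rw [hev]
    rwa [sum_norm_sq_apply_eq T e (stdOrthonormalBasis ℝ F),
      ← sum_norm_sq_apply_eq T b (stdOrthonormalBasis ℝ F)]
  have hTc : Continuous T := T.continuous_of_finiteDimensional
  have hmeas : MeasurableSet {x : E | ‖T x‖ ^ 2 < s} :=
    (isOpen_lt (by fun_prop) continuous_const).measurableSet
  rw [stdGaussian_eq_map_pi_orthonormalBasis e, Measure.map_apply (by fun_prop) hmeas]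
  have hsub : (fun x : Fin n → ℝ => ∑ i, x i • e i) ⁻¹' {x | ‖T x‖ ^ 2 < s} ⊆
      {x | h - s ≤ |∑ i, ev i * x i ^ 2 - ∑ i, ∫ y : ℝ, ev i * y ^ 2 ∂gaussianReal 0 1|} := by
    intro x hx
    simp only [Set.mem_preimage, Set.mem_ofPred_eq] at hx ⊢
    rw [norm_sq_apply_sum_eigenvector hn T] at hx
    simp_rw [integral_weighted_sq]
    rw [abs_sub_comm]
    refine le_trans ?_ (le_abs_self _)
    linarith
  refine (measure_mono hsub).trans ((measure_sum_eval_sub_ge_le (gaussianReal 0 1)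
    (X := fun i x => ev i * x ^ 2) (fun i => memLp_weighted_sq (ev i)) (by linarith)).trans ?_)
  refine ENNReal.ofReal_le_ofReal ?_
  gcongr
  simp_rw [variance_weighted_sq]
  rw [← Finset.sum_mul]
  refine mul_le_mul_of_nonneg_right ?_ chiSqVar_nonneg
  -- Each eigenvalue of T*T is at most K², which bounds the variance of the weighted sum.
  calc ∑ i, ev i ^ 2 ≤ ∑ i : Fin n, K ^ 4 := by
        refine Finset.sum_le_sum fun i _ => ?_
        have h1 := hK (e i)
        rw [e.norm_eq_one, mul_one] at h1
        rw [hev, ← pow_mul]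
        exact pow_le_pow_left₀ (norm_nonneg _) h1 4
    _ = n * K ^ 4 := by simp

theorem integral_stdGaussian_norm_sq {n : ℕ} (hn : Module.finrank ℝ E = n) (T : E →ₗ[ℝ] F)
    (b : OrthonormalBasis (Fin n) ℝ E) :
    Integrable (fun x => ‖T x‖ ^ 2) (stdGaussian E) ∧
      ∫ x, ‖T x‖ ^ 2 ∂stdGaussian E = ∑ i, ‖T (b i)‖ ^ 2 := by
  set e := T.isSymmetric_adjoint_comp_self.eigenvectorBasis hn
  set ev := T.isSymmetric_adjoint_comp_self.eigenvalues hn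
  have hTc : Continuous T := T.continuous_of_finiteDimensional
  have hfun : (fun x : E => ‖T x‖ ^ 2) ∘ (fun x : Fin n → ℝ => ∑ i, x i • e i) =
      ∑ i, fun x : Fin n → ℝ => ev i * x i ^ 2 := by
    ext x
    rw [Function.comp_apply, norm_sq_apply_sum_eigenvector hn T]
    simp
    rfl
  have hm := memLp_sum_eval (gaussianReal 0 1) (fun i => memLp_weighted_sq (ev i))
  rw [stdGaussian_eq_map_pi_orthonormalBasis e]
  constructor
  · rw [integrable_map_measure (by fun_prop) (Measurable.aemeasurable (by fun_prop)), hfun]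
    exact hm.integrable one_le_two
  · rw [integral_map (Measurable.aemeasurable (by fun_prop)) (by fun_prop)]
    have := integral_sum_eval (gaussianReal 0 1) (fun i => memLp_weighted_sq (ev i))
    simp_rw [integral_weighted_sq] at this
    rw [sum_norm_sq_apply_eq T b (stdOrthonormalBasis ℝ F),
      ← sum_norm_sq_apply_eq T e (stdOrthonormalBasis ℝ F)]
    rw [← hfun] at this
    rw [show (∑ i, ‖T (e i)‖ ^ 2) = ∑ i, ev i from
      Finset.sum_congr rfl fun i _ => (eigenvalue_eq_norm_sq hn T i).symm]
    exact this

end Gaussian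

/-! ### Markov for counts, and freezing an independent variable -/

section Counting

/-- Markov's inequality for the number of bad events that occur. -/
theorem measure_card_ge_le {Ω ι : Type*} [MeasurableSpace Ω] (ν : Measure Ω) (I : Finset ι)
    (b : ι → Set Ω) [∀ ω, DecidablePred fun i => ω ∈ b i] (hb : ∀ i, MeasurableSet (b i))
    {ε : ENNReal} (h : ∀ i ∈ I, ν (b i) ≤ ε) (N : ℕ) :
    N * ν {ω | N ≤ (I.filter fun i => ω ∈ b i).card} ≤ I.card * ε := by
  have hm : Measurable fun ω => ∑ i ∈ I, (b i).indicator (fun _ => (1 : ENNReal)) ω :=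
    Finset.measurable_fun_sum _ fun i _ => measurable_const.indicator (hb i)
  have h1 : ∀ ω, ∑ i ∈ I, (b i).indicator (fun _ => (1 : ENNReal)) ω =
      ((I.filter fun i => ω ∈ b i).card : ENNReal) := by
    intro ω
    simp [Set.indicator_apply, Finset.sum_boole]
  have h2 := mul_meas_ge_le_lintegral (μ := ν) hm N
  simp_rw [h1, Nat.cast_le] at h2
  refine h2.trans ?_
  simp_rw [← h1]
  rw [lintegral_finsetSum _ fun i _ => measurable_const.indicator (hb i)]
  calc ∑ i ∈ I, ∫⁻ ω, (b i).indicator (fun _ => (1 : ENNReal)) ω ∂ν = ∑ i ∈ I, ν (b i) := by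
        refine Finset.sum_congr rfl fun i _ => ?_
        exact lintegral_indicator_one (hb i)
    _ ≤ ∑ i ∈ I, ε := Finset.sum_le_sum h
    _ = _ := by simp

/-- By Fubini, a bound valid for each frozen value of X survives averaging. It allows the preceding
rows to be treated as deterministic. -/
theorem measure_prodMk_mem_le {Ω α β : Type*} [MeasurableSpace Ω] [MeasurableSpace α]
    [MeasurableSpace β] (ν : Measure Ω) [IsProbabilityMeasure ν] {X : Ω → α} {Y : Ω → β}
    (hX : Measurable X) (hY : Measurable Y) (hXY : IndepFun X Y ν) {s : Set (α × β)}
    (hs : MeasurableSet s) {ε : ENNReal} (h : ∀ x, ν.map Y {y | (x, y) ∈ s} ≤ ε) :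
    ν {ω | (X ω, Y ω) ∈ s} ≤ ε := by
  have h1 : ν {ω | (X ω, Y ω) ∈ s} = ν.map (fun ω => (X ω, Y ω)) s := by
    rw [Measure.map_apply (hX.prodMk hY) hs]
    rfl
  have := Measure.isProbabilityMeasure_map (μ := ν) hX.aemeasurable
  have := Measure.isProbabilityMeasure_map (μ := ν) hY.aemeasurable
  rw [h1, (indepFun_iff_map_prod_eq_prod_map_map hX.aemeasurable hY.aemeasurable).1 hXY,
    Measure.prod_apply hs]
  calc ∫⁻ x, ν.map Y (Prod.mk x ⁻¹' s) ∂(ν.map X) ≤ ∫⁻ _, ε ∂(ν.map X) := lintegral_mono h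
    _ = ε := by simp

end Counting

/-! ### Gram–Schmidt relative to a subspace -/

section NearSpan

variable {E F : Type*} [NormedAddCommGroup E] [InnerProductSpace ℝ E]
  [NormedAddCommGroup F] [InnerProductSpace ℝ F] {m : ℕ}

/-- The vector `x i` is at distance less than `τ` from the sum of `D` and the span of the vectors
that precede it. -/
def NearSpan (D : Submodule ℝ E) (τ : ℝ) (x : Fin m → E) (i : Fin m) : Prop :=
  ∃ z ∈ D, ∃ α : Fin m → ℝ, ‖x i - (z + ∑ j ∈ Finset.Iio i, α j • x j)‖ < τ

/-- The existential over coefficients is an uncountable union, but of open sets, so measurability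
costs nothing. -/
theorem isOpen_nearSpan (D : Submodule ℝ E) (τ : ℝ) (i : Fin m) :
    IsOpen {x : Fin m → E | NearSpan D τ x i} := by
  have : {x : Fin m → E | NearSpan D τ x i} =
      ⋃ z ∈ D, ⋃ α : Fin m → ℝ, {x | ‖x i - (z + ∑ j ∈ Finset.Iio i, α j • x j)‖ < τ} := by
    ext x
    simp [NearSpan]
  rw [this]
  exact isOpen_biUnion fun z _ => isOpen_iUnion fun α =>
    isOpen_lt (by fun_prop) continuous_const

variable [FiniteDimensional ℝ E] [FiniteDimensional ℝ F]

/-- Orthogonalization of the vectors that are far from the span of the preceding ones. -/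
theorem exists_orthonormal_of_not_nearSpan (D : Submodule ℝ E) {τ : ℝ} (hτ : 0 < τ)
    (x : Fin m → E) (J : Finset (Fin m)) (hJ : ∀ i ∈ J, ¬ NearSpan D τ x i) :
    ∃ q : Fin m → E, (∀ i, q i ∈ Dᗮ) ∧ Orthonormal ℝ (fun i : J => q i) ∧
      ∀ i ∈ J, τ ≤ inner ℝ (x i) (q i) := by
  classical
  -- All preceding vectors enter L i, also those with indices outside J. Hence y j lies in L i for j
  -- < i, so the residuals are mutually orthogonal, and ⟨x i, y i⟩ = ‖y i‖² gives the lower bound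
  -- after normalization.
  let L : Fin m → Submodule ℝ E := fun i => D ⊔ Submodule.span ℝ (x '' (Finset.Iio i : Finset (Fin m)))
  let y : Fin m → E := fun i => x i - (L i).starProjection (x i)
  have hyL : ∀ i, y i ∈ (L i)ᗮ := fun i => (L i).sub_starProjection_mem_orthogonal (x i)
  have hLmono : ∀ i j, i < j → L i ≤ L j := by
    intro i j hij
    refine sup_le_sup_left (Submodule.span_mono (Set.image_mono ?_)) _
    exact_mod_cast Finset.Iio_subset_Iio hij.le
  have hymem : ∀ i j, i < j → y i ∈ L j := by
    intro i j hij
    refine Submodule.sub_mem _ (Submodule.mem_sup_right (Submodule.subset_span ⟨i, by simpa, rfl⟩))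
      (hLmono i j hij ((L i).starProjection_apply_mem _))
  have hyτ : ∀ i ∈ J, τ ≤ ‖y i‖ := by
    intro i hi
    by_contra! hlt
    refine hJ i hi ?_
    obtain ⟨z, hz, w, hw, hzw⟩ := Submodule.mem_sup.1 ((L i).starProjection_apply_mem (x i))
    obtain ⟨α, hα⟩ := (Submodule.mem_span_image_finset_iff_exists_fun' ℝ).1 hw
    exact ⟨z, hz, α, by rw [hα, hzw]; exact hlt⟩
  have hinner : ∀ i, inner ℝ (x i) (y i) = ‖y i‖ ^ 2 := by
    intro i
    have h1 : x i = y i + (L i).starProjection (x i) := by simp [y]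
    conv_lhs => rw [h1]
    rw [inner_add_left, real_inner_self_eq_norm_sq,
      (hyL i) _ ((L i).starProjection_apply_mem _), add_zero]
  refine ⟨fun i => ‖y i‖⁻¹ • y i, fun i => ?_, ⟨fun i => ?_, fun i j hij => ?_⟩, fun i hi => ?_⟩
  · exact Submodule.smul_mem _ _ (Submodule.orthogonal_le le_sup_left (hyL i))
  · have : ‖y i‖ ≠ 0 := (hτ.trans_le (hyτ i i.2)).ne'
    rw [norm_smul, norm_inv, norm_norm, inv_mul_cancel₀ this]
  · dsimp only
    rw [inner_smul_left, inner_smul_right]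
    have hij' : (i : Fin m) ≠ j := fun h => hij (Subtype.ext h)
    have : inner ℝ (y i) (y j) = 0 := by
      rcases lt_or_gt_of_ne hij' with h | h
      · exact hyL j _ (hymem i j h)
      · rw [real_inner_comm]
        exact hyL i _ (hymem j i h)
    simp [this]
  · have h0 : 0 < ‖y i‖ := hτ.trans_le (hyτ i hi)
    rw [inner_smul_right, hinner, sq, ← mul_assoc, inv_mul_cancel₀ h0.ne', one_mul]
    exact hyτ i hi

/-- Projecting to the orthogonal complement of a subspace of small dimension removes only a small
part of the sum of squares. -/
theorem le_sum_norm_sq_starProjection {ι : Type*} [Fintype ι] (T : E →ₗ[ℝ] F)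
    (L : Submodule ℝ F) {K : ℝ} (hK : ∀ x, ‖LinearMap.adjoint T x‖ ≤ K * ‖x‖)
    (b : OrthonormalBasis ι ℝ E) :
    ∑ i, ‖T (b i)‖ ^ 2 - Module.finrank ℝ L * K ^ 2 ≤ ∑ i, ‖Lᗮ.starProjection (T (b i))‖ ^ 2 := by
  have h1 : ∀ x, ‖x‖ ^ 2 = ‖L.starProjection x‖ ^ 2 + ‖Lᗮ.starProjection x‖ ^ 2 := fun x =>
    Submodule.norm_sq_eq_add_norm_sq_starProjection x L
  -- Expanding in an orthonormal basis f of L and exchanging sums turns the left side into Σ ‖T*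
  -- f_l‖².
  have h2 : ∑ i, ‖L.starProjection (T (b i))‖ ^ 2 ≤ Module.finrank ℝ L * K ^ 2 := by
    let f := stdOrthonormalBasis ℝ L
    have h3 : ∀ i, ‖L.starProjection (T (b i))‖ ^ 2 =
        ∑ l, inner ℝ (LinearMap.adjoint T (f l)) (b i) ^ 2 := by
      intro i
      rw [Submodule.starProjection_apply, Submodule.norm_coe, ← f.sum_sq_inner_right]
      refine Finset.sum_congr rfl fun l _ => ?_
      rw [LinearMap.adjoint_inner_left, Submodule.coe_inner, ← Submodule.starProjection_apply,
        ← Submodule.inner_starProjection_left_eq_right,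
        Submodule.starProjection_eq_self_iff.2 (f l).2]
    simp_rw [h3]
    rw [Finset.sum_comm]
    calc ∑ l, ∑ i, inner ℝ (LinearMap.adjoint T (f l)) (b i) ^ 2
        = ∑ l, ‖LinearMap.adjoint T (f l)‖ ^ 2 := by
          simp_rw [← b.sum_sq_inner_left]
      _ ≤ ∑ l : Fin (Module.finrank ℝ L), K ^ 2 := by
          refine Finset.sum_le_sum fun l _ => ?_
          have := hK (f l)
          rw [Submodule.norm_coe, f.norm_eq_one, mul_one] at this
          exact pow_le_pow_left₀ (norm_nonneg _) this 2
      _ = _ := by simp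
  have h4 : ∑ i, ‖T (b i)‖ ^ 2 = ∑ i, ‖L.starProjection (T (b i))‖ ^ 2 +
      ∑ i, ‖Lᗮ.starProjection (T (b i))‖ ^ 2 := by
    rw [← Finset.sum_add_distrib]
    exact Finset.sum_congr rfl fun i _ => h1 _
  linarith

end NearSpan

/-! ### Nuclear norm from rows in general position -/

section NuclearLowerBound

variable {m k : ℕ}

/-- Trace duality is unchanged when both factors change sign. It disposes of the minus sign in the
gradient. -/
theorem nuclearNorm_le_nuclearNorm_neg (M : Matrix (Fin m) (Fin k) ℝ) :
    nuclearNorm M ≤ nuclearNorm (-M) := by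
  obtain ⟨Y, hY, h⟩ := exists_trace_mul_eq_nuclearNorm M
  have h1 := trace_mul_le_nuclearNorm (-M) (-Y)
  rw [Matrix.neg_mul, Matrix.mul_neg, neg_neg, h, norm_neg] at h1
  exact h1.trans (mul_le_of_le_one_left (nuclearNorm_nonneg _) hY)

/-- The image under `Sᵀ` of a row vector. -/
noncomputable def rowImage (S : Matrix (Fin k) (Fin k) ℝ) (y : Fin k → ℝ) : EuclideanSpace ℝ (Fin k) :=
  Matrix.toEuclideanLin Sᵀ (WithLp.toLp 2 y)

theorem continuous_rowImage (S : Matrix (Fin k) (Fin k) ℝ) : Continuous (rowImage S) :=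
  (LinearMap.continuous_of_finiteDimensional _).comp (PiLp.continuous_toLp 2 _)

theorem inner_rowImage (S : Matrix (Fin k) (Fin k) ℝ) (W : Matrix (Fin m) (Fin k) ℝ) (i : Fin m)
    (x : EuclideanSpace ℝ (Fin k)) :
    inner ℝ (rowImage S (W i)) x = Matrix.toEuclideanLin (W * S) x i := by
  rw [rowImage, toEuclideanLin_transpose, LinearMap.adjoint_inner_left, toEuclideanLin_mul,
    toEuclideanLin_apply_coord]
  simp [PiLp.inner_apply, mul_comm]

/-- A matrix that acts like `s W S` on the orthogonal complement of `D` after a right multiplication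
has large nuclear norm if many rows of `W S` are far from the span of `D` and the preceding rows. -/
theorem card_mul_le_nuclearNorm (M W : Matrix (Fin m) (Fin k) ℝ) (R S : Matrix (Fin k) (Fin k) ℝ)
    (D : Submodule ℝ (EuclideanSpace ℝ (Fin k))) {s τ : ℝ} (hs : 0 ≤ s) (hτ : 0 < τ)
    (hM : ∀ x ∈ Dᗮ, Matrix.toEuclideanLin (M * R) x = s • Matrix.toEuclideanLin (W * S) x)
    (J : Finset (Fin m)) (hJ : ∀ i ∈ J, ¬ NearSpan D τ (fun i => rowImage S (W i)) i) :
    s * (J.card * τ) ≤ ‖R‖ * nuclearNorm M := by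
  classical
  obtain ⟨q, hqD, hqo, hqτ⟩ := exists_orthonormal_of_not_nearSpan D hτ _ J hJ
  -- The dual test matrix: column i is q i for i in J and zero otherwise, so ‖Z‖ ≤ 1 is Bessel and
  -- the diagonal of M R Z collects the inner products of rows of W S with their own q i.
  let Z : Matrix (Fin k) (Fin m) ℝ := Matrix.of fun a i => if i ∈ J then q i a else 0
  have hZ : ‖Z‖ ≤ 1 := by
    rw [← norm_transpose]
    refine norm_le_of_toEuclideanLin _ zero_le_one fun x => ?_
    rw [one_mul]
    refine le_of_sq_le_sq ?_ (norm_nonneg _)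
    rw [EuclideanSpace.real_norm_sq_eq]
    have h1 : ∀ i, Matrix.toEuclideanLin Zᵀ x i = if i ∈ J then inner ℝ (q i) x else 0 := by
      intro i
      rw [toEuclideanLin_apply_coord]
      split_ifs with h
      · simp [Z, h, PiLp.inner_apply, mul_comm]
      · simp [Z, h]
    simp_rw [h1]
    have h2 := hqo.sum_inner_products_le x (s := Finset.univ)
    refine le_trans (le_of_eq ?_) h2
    simp only [ite_pow, ne_eq, OfNat.ofNat_ne_zero, not_false_eq_true, zero_pow,
      Real.norm_eq_abs, sq_abs]
    rw [Finset.sum_ite_mem, Finset.univ_inter, ← Finset.sum_coe_sort]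
  have htr : (M * (R * Z)).trace = ∑ i ∈ J, s * inner ℝ (rowImage S (W i)) (q i) := by
    rw [Matrix.trace, ← Matrix.mul_assoc]
    have h1 : ∀ i, ((M * R) * Z).diag i =
        if i ∈ J then s * inner ℝ (rowImage S (W i)) (q i) else 0 := by
      intro i
      rw [Matrix.diag_apply, Matrix.mul_apply]
      split_ifs with h
      · have := congrArg (fun v : EuclideanSpace ℝ (Fin m) => v i) (hM (q i) (hqD i))
        simp only [PiLp.smul_apply, smul_eq_mul] at this
        rw [inner_rowImage, ← this, toEuclideanLin_apply_coord]
        simp [Z, h]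
      · simp [Z, h]
    simp_rw [h1]
    rw [Finset.sum_ite_mem, Finset.univ_inter]
  calc s * (J.card * τ) = ∑ i ∈ J, s * τ := by simp; ring
    _ ≤ ∑ i ∈ J, s * inner ℝ (rowImage S (W i)) (q i) :=
        Finset.sum_le_sum fun i hi => mul_le_mul_of_nonneg_left (hqτ i hi) hs
    _ ≤ ‖R * Z‖ * nuclearNorm M := htr ▸ trace_mul_le_nuclearNorm M (R * Z)
    _ ≤ ‖R‖ * nuclearNorm M := by
        refine mul_le_mul_of_nonneg_right ?_ (nuclearNorm_nonneg _)
        refine (Matrix.l2_opNorm_mul _ _).trans (mul_le_of_le_one_right (norm_nonneg _) hZ)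

end NuclearLowerBound

/-! ### Distance of a Gaussian row from the preceding ones -/

section GaussianMatrix

variable {m k p : ℕ}

/-- The law of a matrix with independent standard Gaussian entries. -/
noncomputable def gaussianMatrix (m k : ℕ) : Measure (Fin m → Fin k → ℝ) :=
  Measure.pi fun _ => Measure.pi fun _ => gaussianReal 0 1

instance : IsProbabilityMeasure (gaussianMatrix m k) := by
  unfold gaussianMatrix
  infer_instance

theorem measurableSet_nearSpan_rowImage (D : Submodule ℝ (EuclideanSpace ℝ (Fin k)))
    (S : Matrix (Fin k) (Fin k) ℝ) (τ : ℝ) (i : Fin m) :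
    MeasurableSet {G : Fin m → Fin k → ℝ | NearSpan D τ (fun i => rowImage S (G i)) i} := by
  have hc : Continuous fun (G : Fin m → Fin k → ℝ) i => rowImage S (G i) :=
    continuous_pi fun i => (continuous_rowImage S).comp (continuous_apply i)
  exact ((isOpen_nearSpan D τ i).preimage hc).measurableSet

/-- The mean squared length of the projected row is at least ‖S‖_F² minus K² for each dimension of
L; Chebyshev controls the deviation below it. -/
theorem pi_gaussianReal_norm_rowImage_lt_le (S : Matrix (Fin k) (Fin k) ℝ) {K : ℝ} (hS : ‖S‖ ≤ K)
    (L : Submodule ℝ (EuclideanSpace ℝ (Fin k))) {h s : ℝ}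
    (hh : h ≤ frobNorm S ^ 2 - Module.finrank ℝ L * K ^ 2) (hs : s < h) :
    (Measure.pi fun _ : Fin k => gaussianReal 0 1)
      {y | ‖Lᗮ.starProjection (rowImage S y)‖ ^ 2 < s} ≤
        ENNReal.ofReal (k * K ^ 4 * chiSqVar / (h - s) ^ 2) := by
  let T : EuclideanSpace ℝ (Fin k) →ₗ[ℝ] EuclideanSpace ℝ (Fin k) :=
    Lᗮ.starProjection.toLinearMap ∘ₗ Matrix.toEuclideanLin Sᵀ
  have hK : 0 ≤ K := (norm_nonneg _).trans hS
  have hSt : ∀ x, ‖Matrix.toEuclideanLin Sᵀ x‖ ≤ K * ‖x‖ := fun x =>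
    (norm_toEuclideanLin_apply_le _ _).trans (by rw [norm_transpose]; gcongr)
  have h1 := stdGaussian_norm_sq_lt_le (E := EuclideanSpace ℝ (Fin k)) finrank_euclideanSpace_fin T
    (K := K) (h := h) (s := s)
    (fun x => (Lᗮ.norm_starProjection_apply_le _).trans (hSt x)) (EuclideanSpace.basisFun (Fin k) ℝ)
    (by
      refine hh.trans (le_trans ?_ (le_sum_norm_sq_starProjection (Matrix.toEuclideanLin Sᵀ) L
        (K := K) (fun x => ?_) (EuclideanSpace.basisFun (Fin k) ℝ)))
      · rw [toEuclideanLin_transpose, ← sum_norm_sq_apply_eq _ (EuclideanSpace.basisFun (Fin k) ℝ),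
          ← frobNorm_sq_eq_sum_basis]
      · rw [← toEuclideanLin_transpose, Matrix.transpose_transpose]
        exact (norm_toEuclideanLin_apply_le _ _).trans (by gcongr)) hs
  refine le_trans (le_of_eq ?_) h1
  rw [← map_pi_eq_stdGaussian, Measure.map_apply (by fun_prop)]
  · rfl
  · have : Continuous T := T.continuous_of_finiteDimensional
    exact (isOpen_lt (by fun_prop) continuous_const).measurableSet

/-- A row of `G S` is unlikely to be close to the span of `D` and the preceding rows. -/
theorem gaussianMatrix_nearSpan_le (D : Submodule ℝ (EuclideanSpace ℝ (Fin k)))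
    (S : Matrix (Fin k) (Fin k) ℝ) {K : ℝ} (hS : ‖S‖ ≤ K) (i : Fin m) {h τ : ℝ}
    (hh : h ≤ frobNorm S ^ 2 - (Module.finrank ℝ D + i : ℕ) * K ^ 2) (hs : τ ^ 2 < h) :
    gaussianMatrix m k {G | NearSpan D τ (fun i => rowImage S (G i)) i} ≤
      ENNReal.ofReal (k * K ^ 4 * chiSqVar / (h - τ ^ 2) ^ 2) := by
  classical
  let ρ : Measure (Fin k → ℝ) := Measure.pi fun _ => gaussianReal 0 1
  have hind : iIndepFun (fun (i : Fin m) (G : Fin m → Fin k → ℝ) => G i) (gaussianMatrix m k) :=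
    iIndepFun_pi (μ := fun _ : Fin m => ρ) (X := fun _ => id) (fun _ => aemeasurable_id)
  have hXY := (hind.indepFun_finset (Finset.Iio i) {i} (by simp) fun j => measurable_pi_apply j).comp
    measurable_id (measurable_pi_apply (⟨i, by simp⟩ : ({i} : Finset (Fin m))))
  -- The event as a condition on the pair (preceding rows, row i), whose members are independent.
  let s : Set ((Finset.Iio i → Fin k → ℝ) × (Fin k → ℝ)) :=
    ⋃ z ∈ D, ⋃ α : Fin m → ℝ, {a | ‖rowImage S a.2 -
      (z + ∑ j : Finset.Iio i, α j • rowImage S (a.1 j))‖ < τ}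
  have hs : MeasurableSet s := by
    refine (isOpen_biUnion fun z _ => isOpen_iUnion fun α =>
      isOpen_lt ?_ continuous_const).measurableSet
    have := continuous_rowImage S
    fun_prop
  have hset : {G : Fin m → Fin k → ℝ | NearSpan D τ (fun i => rowImage S (G i)) i} =
      {G | ((fun j : Finset.Iio i => G j), G i) ∈ s} := by
    ext G
    simp only [NearSpan, s, Set.mem_ofPred_eq, Set.mem_iUnion, exists_prop]
    refine exists_congr fun z => and_congr_right fun _ => exists_congr fun α => ?_
    rw [Finset.sum_coe_sort (Finset.Iio i) fun j => α j • rowImage S (G j)]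
  rw [hset]
  refine measure_prodMk_mem_le (gaussianMatrix m k) (by fun_prop) (by fun_prop) hXY hs fun a => ?_
  change (gaussianMatrix m k).map (fun G => G i) _ ≤ _
  have hmap : (gaussianMatrix m k).map (fun G => G i) = ρ :=
    (measurePreserving_eval (fun _ : Fin m => ρ) i).map_eq
  rw [hmap]
  -- With the preceding rows frozen this is a fixed subspace, and being within τ of it makes the
  -- projection to Lᗮ shorter than τ.
  let L : Submodule ℝ (EuclideanSpace ℝ (Fin k)) :=
    D ⊔ Submodule.span ℝ (Set.range fun j : Finset.Iio i => rowImage S (a j))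
  have hL : Module.finrank ℝ L ≤ Module.finrank ℝ D + i := by
    refine (Submodule.finrank_add_le_finrank_add_finrank _ _).trans ?_
    gcongr
    refine (finrank_range_le_card _).trans ?_
    rw [Fintype.card_coe, Fin.card_Iio]
  refine le_trans (measure_mono ?_) (pi_gaussianReal_norm_rowImage_lt_le S hS L (h := h) (s := τ ^ 2)
    (hh.trans ?_) ‹_›)
  · intro y hy
    simp only [s, Set.mem_ofPred_eq, Set.mem_iUnion, exists_prop] at hy ⊢
    obtain ⟨z, hz, α, hα⟩ := hy
    set l := z + ∑ j : Finset.Iio i, α j • rowImage S (a j) with hl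
    have hlL : l ∈ L := Submodule.add_mem _ (Submodule.mem_sup_left hz)
      (Submodule.mem_sup_right (Submodule.sum_mem _ fun j _ => Submodule.smul_mem _ _
        (Submodule.subset_span ⟨j, rfl⟩)))
    have h0 : Lᗮ.starProjection l = 0 := by
      rw [Submodule.starProjection_apply_eq_zero_iff, Submodule.orthogonal_orthogonal]
      exact hlL
    have h1 : ‖Lᗮ.starProjection (rowImage S y)‖ ≤ ‖rowImage S y - l‖ := by
      have := Lᗮ.norm_starProjection_apply_le (rowImage S y - l)
      rwa [map_sub, h0, sub_zero] at this
    exact pow_lt_pow_left₀ (h1.trans_lt hα) (norm_nonneg _) two_ne_zero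
  · gcongr

end GaussianMatrix

/-! ### The exceptional events for a Gaussian matrix -/

section Tails

variable {m k p : ℕ}

/-- The squared norm has mean mk and variance mk times `chiSqVar`; this is Chebyshev over
independent rows. -/
theorem gaussianMatrix_frobNorm_ge_le {s : ℝ} (hs : 0 < s) :
    gaussianMatrix m k {G | (m * k : ℝ) + s ≤ frobNorm (Matrix.of G) ^ 2} ≤
      ENNReal.ofReal (m * k * chiSqVar / s ^ 2) := by
  let ρ : Measure (Fin k → ℝ) := Measure.pi fun _ => gaussianReal 0 1
  let f : (Fin k → ℝ) → ℝ := ∑ j, fun y => y j ^ 2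
  have hf : MemLp f 2 ρ := memLp_sum_eval (gaussianReal 0 1) fun _ => memLp_sq_gaussianReal
  have hmean : ∫ y, f y ∂ρ = k := by
    rw [integral_sum_eval (gaussianReal 0 1) fun _ => memLp_sq_gaussianReal]
    simp [integral_sq_gaussianReal]
  have hvar : Var[f; ρ] = k * chiSqVar := by
    rw [variance_sum_pi (X := fun _ x => x ^ 2) fun _ => memLp_sq_gaussianReal]
    simp [chiSqVar]
  have h := measure_sum_eval_sub_ge_le (ι := Fin m) ρ (X := fun _ => f) (fun _ => hf) hs
  simp only [hmean, hvar, Finset.sum_const, Finset.card_univ, Fintype.card_fin, nsmul_eq_mul] at h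
  rw [← mul_assoc] at h
  refine le_trans (measure_mono fun G hG => ?_) h
  simp only [Set.mem_ofPred_eq] at hG ⊢
  refine le_trans ?_ (le_abs_self _)
  rw [frobNorm_sq] at hG
  simp only [f, Finset.sum_apply]
  simp only [Matrix.of_apply] at hG
  linarith

theorem frobNorm_transpose (M : Matrix (Fin m) (Fin k) ℝ) : frobNorm Mᵀ = frobNorm M := by
  rw [frobNorm, frobNorm, Finset.sum_comm]
  rfl

theorem frobNorm_sq_of_isometry {V : Matrix (Fin k) (Fin p) ℝ} (hV : Vᵀ * V = 1) :
    frobNorm V ^ 2 = p := by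
  rw [frobNorm_sq_eq_sum_basis V (EuclideanSpace.basisFun (Fin p) ℝ)]
  simp [norm_toEuclideanLin_of_isometry hV]

/-- The mean is m‖V‖_F² = mp. Markov is enough, since the growth condition on p makes the mean
negligible against the threshold used later. -/
theorem gaussianMatrix_frobNorm_mul_ge_le {V : Matrix (Fin k) (Fin p) ℝ} (hV : Vᵀ * V = 1)
    {s : ℝ} (hs : 0 < s) :
    gaussianMatrix m k {G | s ≤ frobNorm (Matrix.of G * V) ^ 2} ≤ ENNReal.ofReal (m * p / s) := by
  let ρ : Measure (Fin k → ℝ) := Measure.pi fun _ => gaussianReal 0 1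
  let f : (Fin k → ℝ) → ℝ := fun y => ‖Matrix.toEuclideanLin Vᵀ (WithLp.toLp 2 y)‖ ^ 2
  have hfc : Continuous fun x => ‖Matrix.toEuclideanLin Vᵀ x‖ ^ 2 := by
    have := LinearMap.continuous_of_finiteDimensional (Matrix.toEuclideanLin Vᵀ)
    fun_prop
  obtain ⟨h1, h2⟩ := integral_stdGaussian_norm_sq (E := EuclideanSpace ℝ (Fin k))
    finrank_euclideanSpace_fin (Matrix.toEuclideanLin Vᵀ) (EuclideanSpace.basisFun (Fin k) ℝ)
  rw [← frobNorm_sq_eq_sum_basis, frobNorm_transpose, frobNorm_sq_of_isometry hV,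
    ← map_pi_eq_stdGaussian, integral_map (Measurable.aemeasurable (by fun_prop))
      hfc.aestronglyMeasurable] at h2
  rw [← map_pi_eq_stdGaussian, integrable_map_measure hfc.aestronglyMeasurable
    (Measurable.aemeasurable (by fun_prop))] at h1
  have hfrob : ∀ G : Fin m → Fin k → ℝ, frobNorm (Matrix.of G * V) ^ 2 = ∑ i, f (G i) := by
    intro G
    rw [frobNorm_sq_eq_sum_row]
    refine Finset.sum_congr rfl fun i _ => ?_
    simp only [f]
    congr 2
    ext j
    rw [toEuclideanLin_apply_coord]
    simp [Matrix.mul_apply, mul_comm]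
  have hint : ∀ i : Fin m, Integrable (fun G : Fin m → Fin k → ℝ => f (G i)) (gaussianMatrix m k) :=
    fun i => integrable_comp_eval (μ := fun _ : Fin m => ρ) (i := i) (f := f) h1
  have hmean : ∫ G, ∑ i, f (G i) ∂(gaussianMatrix m k) = m * p := by
    rw [integral_finsetSum _ fun i _ => hint i]
    have : ∀ i : Fin m, ∫ G, f (G i) ∂(gaussianMatrix m k) = p := fun i =>
      (integral_comp_eval (μ := fun _ : Fin m => ρ) (f := f) h1.aestronglyMeasurable).trans h2
    simp [this]
  have h3 := mul_meas_ge_le_integral_of_nonneg (μ := gaussianMatrix m k)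
    (f := fun G => ∑ i, f (G i))
    (ae_of_all _ fun G => Finset.sum_nonneg fun i _ => sq_nonneg _)
    (integrable_finsetSum _ fun i _ => hint i) s
  rw [hmean] at h3
  simp_rw [hfrob]
  rw [← ofReal_measureReal (measure_ne_top _ _)]
  refine ENNReal.ofReal_le_ofReal ?_
  rw [le_div_iff₀ hs, mul_comm]
  exact h3

open Classical in
/-- With high probability at least half of the first `N` rows of `G S` are far from the span of `D`
and the rows that precede them. -/
theorem gaussianMatrix_card_nearSpan_le (D : Submodule ℝ (EuclideanSpace ℝ (Fin k)))
    (S : Matrix (Fin k) (Fin k) ℝ) {K : ℝ} (hS : ‖S‖ ≤ K) {N : ℕ} (hN : N ≤ m) {h τ : ℝ}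
    (hh : h ≤ frobNorm S ^ 2 - (Module.finrank ℝ D + N : ℕ) * K ^ 2) (hτ : τ ^ 2 < h) :
    gaussianMatrix m k {G | 2 * ((Finset.univ.filter fun i : Fin m => (i : ℕ) < N).filter fun i =>
        ¬ NearSpan D τ (fun i => rowImage S (G i)) i).card < N} ≤
      ENNReal.ofReal (2 * (k * K ^ 4 * chiSqVar / (h - τ ^ 2) ^ 2)) := by
  set I := Finset.univ.filter fun i : Fin m => (i : ℕ) < N
  set ε := k * K ^ 4 * chiSqVar / (h - τ ^ 2) ^ 2
  have hε : 0 ≤ ε := by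
    have := chiSqVar_nonneg
    positivity
  have hI : I.card = N := by
    rw [Fin.card_filter_val_lt, min_eq_right hN]
  -- Fewer than N/2 good rows means at least ⌊N/2⌋ + 1 bad ones, and Markov then costs N/(⌊N/2⌋ + 1)
  -- ≤ 2.
  have h1 := measure_card_ge_le (gaussianMatrix m k) I
    (fun i => {G | NearSpan D τ (fun i => rowImage S (G i)) i})
    (fun i => measurableSet_nearSpan_rowImage D S τ i) (ε := ENNReal.ofReal ε)
    (fun i hi => gaussianMatrix_nearSpan_le D S hS i (hh.trans (by
      have : (i : ℕ) ≤ N := (Finset.mem_filter.1 hi).2.le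
      gcongr)) hτ) (N / 2 + 1)
  rw [hI] at h1
  have h2 : {G : Fin m → Fin k → ℝ | 2 * (I.filter fun i =>
        ¬ NearSpan D τ (fun i => rowImage S (G i)) i).card < N} ⊆
      {G | N / 2 + 1 ≤ (I.filter fun i => G ∈ {G : Fin m → Fin k → ℝ |
        NearSpan D τ (fun i => rowImage S (G i)) i}).card} := by
    intro G hG
    simp only [Set.mem_ofPred_eq] at hG ⊢
    have h3 := Finset.card_filter_add_card_filter_not (s := I)
      (fun i => NearSpan D τ (fun i => rowImage S (G i)) i)
    omega
  refine (measure_mono h2).trans ?_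
  set x := gaussianMatrix m k {G | N / 2 + 1 ≤ (I.filter fun i => G ∈ {G : Fin m → Fin k → ℝ |
        NearSpan D τ (fun i => rowImage S (G i)) i}).card} with hx
  have hxt : x ≠ ⊤ := measure_ne_top _ _
  rw [← ENNReal.ofReal_toReal hxt]
  refine ENNReal.ofReal_le_ofReal ?_
  have h4 := ENNReal.toReal_mono (by finiteness) h1
  rw [ENNReal.toReal_mul, ENNReal.toReal_mul, ENNReal.toReal_ofReal hε, ENNReal.toReal_natCast,
    ENNReal.toReal_natCast] at h4
  have h5 : (N : ℝ) ≤ 2 * ((N / 2 + 1 : ℕ) : ℝ) := by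
    have : N ≤ 2 * (N / 2 + 1) := by omega
    exact_mod_cast this
  have h6 : (0 : ℝ) < ((N / 2 + 1 : ℕ) : ℝ) := by positivity
  have h7 : ((N / 2 + 1 : ℕ) : ℝ) * x.toReal ≤ ((N / 2 + 1 : ℕ) : ℝ) * (2 * ε) := by
    nlinarith
  exact le_of_mul_le_mul_left h7 h6

end Tails

/-! ### The teacher as a rescaled standard Gaussian matrix -/

section Law

variable {m k : ℕ}

/-- The entries of a standard Gaussian matrix are independent. -/
theorem iIndepFun_gaussianMatrix_entries :
    iIndepFun (fun (ij : Fin m × Fin k) (G : Fin m → Fin k → ℝ) => G ij.1 ij.2)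
      (gaussianMatrix m k) := by
  let ρ : Measure (Fin k → ℝ) := Measure.pi fun _ => gaussianReal 0 1
  refine iIndepFun_uncurry' (X := fun i j (G : Fin m → Fin k → ℝ) => G i j) (fun i j => by fun_prop)
    ?_ fun i => ?_
  · exact iIndepFun_pi (μ := fun _ : Fin m => ρ) (X := fun _ => id) (fun _ => aemeasurable_id)
  · have h := (iIndepFun_iff_map_fun_eq_pi_map (f := fun (j : Fin k) (y : Fin k → ℝ) => y j)
      fun j => (measurable_pi_apply j).aemeasurable).1 (iIndepFun_pi
        (μ := fun _ : Fin k => gaussianReal 0 1) (X := fun _ => id) (fun _ => aemeasurable_id))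
    refine (iIndepFun_iff_map_fun_eq_pi_map (f := fun (j : Fin k) (G : Fin m → Fin k → ℝ) => G i j)
      fun j => Measurable.aemeasurable (by fun_prop)).2 ?_
    have hmp := measurePreserving_eval (fun _ : Fin m => ρ) i
    have hmap : ∀ {β : Type} [MeasurableSpace β] (g : (Fin k → ℝ) → β), Measurable g →
        (gaussianMatrix m k).map (fun G => g (G i)) = ρ.map g := by
      intro β _ g hg
      rw [← hmp.map_eq, Measure.map_map hg hmp.measurable]
      rfl
    rw [hmap (fun y j => y j) (by fun_prop)]
    simp_rw [fun j => hmap (fun y => y j) (by fun_prop)]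
    exact h

/-- The law of a random matrix with independent centred Gaussian entries of variance `1 / d`. -/
theorem map_eq_map_gaussianMatrix {Ω : Type*} [MeasurableSpace Ω] {μ : Measure Ω}
    [IsProbabilityMeasure μ] {d : ℕ} {W : Ω → Matrix (Fin m) (Fin k) ℝ}
    (hW : ∀ i j, Measurable fun ω => W ω i j)
    (hgauss : ∀ i j, HasLaw (fun ω => W ω i j) (gaussianReal 0 (d : ℝ≥0)⁻¹) μ)
    (hiid : iIndepFun (fun (ij : Fin m × Fin k) ω => W ω ij.1 ij.2) μ) :
    μ.map (fun ω i j => W ω i j) =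
      (gaussianMatrix m k).map fun G i j => (√(d : ℝ))⁻¹ * G i j := by
  let e : (Fin m → Fin k → ℝ) ≃ᵐ (Fin m × Fin k → ℝ) := (MeasurableEquiv.curry (Fin m) (Fin k) ℝ).symm
  have hWm : Measurable fun ω i j => W ω i j := by
    refine measurable_pi_lambda _ fun i => measurable_pi_lambda _ fun j => hW i j
  -- After uncurrying, independence makes both laws products of their one-entry marginals.
  refine e.map_measurableEquiv_injective ?_
  rw [Measure.map_map e.measurable hWm, Measure.map_map e.measurable (by fun_prop)]
  refine Eq.trans ((iIndepFun_iff_map_fun_eq_pi_map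
    (f := fun (ij : Fin m × Fin k) ω => W ω ij.1 ij.2)
      fun ij => (hW ij.1 ij.2).aemeasurable).1 hiid) (Eq.symm (Eq.trans
    ((iIndepFun_iff_map_fun_eq_pi_map
      (f := fun (ij : Fin m × Fin k) (G : Fin m → Fin k → ℝ) => (√(d : ℝ))⁻¹ * G ij.1 ij.2)
      (fun ij => Measurable.aemeasurable (by fun_prop))).1
      (iIndepFun_gaussianMatrix_entries.comp (fun _ x => (√(d : ℝ))⁻¹ * x) (fun _ => by fun_prop))) ?_))
  congr 1
  ext1 ij
  refine Eq.trans ?_ (hgauss ij.1 ij.2).map_eq.symm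
  have h3 : (gaussianMatrix m k).map (fun G => G ij.1 ij.2) = gaussianReal 0 1 := by
    have h4 := measurePreserving_eval (fun _ : Fin m => Measure.pi fun _ : Fin k => gaussianReal 0 1)
      ij.1
    have h5 := measurePreserving_eval (fun _ : Fin k => gaussianReal 0 1) ij.2
    exact (h5.comp h4).map_eq
  have h6 : (fun x => (√(d : ℝ))⁻¹ * x) ∘ (fun G : Fin m → Fin k → ℝ => G ij.1 ij.2) =
      fun G => (√(d : ℝ))⁻¹ * G ij.1 ij.2 := rfl
  rw [← h6, ← Measure.map_map (by fun_prop) (by fun_prop), h3, gaussianReal_map_const_mul]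
  congr 1
  · simp
  · ext
    simp

end Law

/-! ### Measurability of the event -/

section Measurability

variable {X : Type*} [MeasurableSpace X] {a b c : ℕ}

/-- A matrix valued function with measurable entries. -/
def MeasurableEntries (M : X → Matrix (Fin a) (Fin b) ℝ) : Prop :=
  ∀ i j, Measurable fun x => M x i j

theorem MeasurableEntries.mul {M : X → Matrix (Fin a) (Fin b) ℝ} {N : X → Matrix (Fin b) (Fin c) ℝ}
    (hM : MeasurableEntries M) (hN : MeasurableEntries N) :
    MeasurableEntries fun x => M x * N x := by
  intro i j
  simp only [Matrix.mul_apply]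
  exact Finset.measurable_fun_sum _ fun l _ => (hM i l).mul (hN l j)

theorem MeasurableEntries.sub {M N : X → Matrix (Fin a) (Fin b) ℝ}
    (hM : MeasurableEntries M) (hN : MeasurableEntries N) :
    MeasurableEntries fun x => M x - N x := fun i j => (hM i j).sub (hN i j)

theorem MeasurableEntries.neg {M : X → Matrix (Fin a) (Fin b) ℝ}
    (hM : MeasurableEntries M) : MeasurableEntries fun x => -M x := fun i j => (hM i j).neg

theorem MeasurableEntries.smul {M : X → Matrix (Fin a) (Fin b) ℝ} {f : X → ℝ}
    (hf : Measurable f) (hM : MeasurableEntries M) :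
    MeasurableEntries fun x => f x • M x := fun i j => hf.mul (hM i j)

theorem MeasurableEntries.const (M : Matrix (Fin a) (Fin b) ℝ) :
    MeasurableEntries fun _ : X => M := fun _ _ => measurable_const

theorem MeasurableEntries.transpose {M : X → Matrix (Fin a) (Fin b) ℝ}
    (hM : MeasurableEntries M) : MeasurableEntries fun x => (M x)ᵀ := fun i j => hM j i

theorem MeasurableEntries.pow {M : X → Matrix (Fin a) (Fin a) ℝ}
    (hM : MeasurableEntries M) (t : ℕ) : MeasurableEntries fun x => M x ^ t := by
  induction t with
  | zero => simpa using MeasurableEntries.const (X := X) 1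
  | succ t ih => simpa only [pow_succ] using ih.mul hM

theorem MeasurableEntries.gram {k n : ℕ} {A : X → Matrix (Fin k) (Fin n) ℝ}
    (hA : MeasurableEntries A) : MeasurableEntries fun x => gram (A x) :=
  MeasurableEntries.smul measurable_const (hA.mul hA.transpose)

theorem MeasurableEntries.crossGram {k n : ℕ} {A Abar : X → Matrix (Fin k) (Fin n) ℝ}
    (hA : MeasurableEntries A) (hAbar : MeasurableEntries Abar) :
    MeasurableEntries fun x => crossGram (A x) (Abar x) :=
  MeasurableEntries.smul measurable_const (hAbar.mul hA.transpose)

theorem MeasurableEntries.frobNorm {M : X → Matrix (Fin a) (Fin b) ℝ}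
    (hM : MeasurableEntries M) : Measurable fun x => frobNorm (M x) :=
  (Finset.measurable_fun_sum _ fun i _ => Finset.measurable_fun_sum _ fun j _ =>
    (hM i j).pow_const 2).sqrt

theorem MeasurableEntries.curry {M : X → Matrix (Fin a) (Fin b) ℝ}
    (hM : MeasurableEntries M) : Measurable fun x i j => M x i j :=
  measurable_pi_lambda _ fun i => measurable_pi_lambda _ fun j => hM i j

theorem MeasurableEntries.opNorm {M : X → Matrix (Fin a) (Fin a) ℝ}
    (hM : MeasurableEntries M) : Measurable fun x => opNorm (M x) := by
  have h : Continuous fun f : Fin a → Fin a → ℝ => ‖(Matrix.of f : Matrix (Fin a) (Fin a) ℝ)‖ :=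
    continuous_norm.comp continuous_id
  exact h.measurable.comp hM.curry

/-- By trace duality the nuclear norm is a supremum of linear functionals, so its superlevel sets
are open. -/
theorem MeasurableEntries.nuclearNorm {M : X → Matrix (Fin a) (Fin b) ℝ}
    (hM : MeasurableEntries M) : Measurable fun x => nuclearNorm (M x) := by
  have h : Measurable fun f : Fin a → Fin b → ℝ =>
      MultiSpike.nuclearNorm (Matrix.of f : Matrix (Fin a) (Fin b) ℝ) := by
    refine measurable_of_Ioi fun s => IsOpen.measurableSet ?_
    have : (fun f : Fin a → Fin b → ℝ =>
        MultiSpike.nuclearNorm (Matrix.of f : Matrix (Fin a) (Fin b) ℝ)) ⁻¹' Set.Ioi s =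
        ⋃ Y : {Y : Matrix (Fin b) (Fin a) ℝ // ‖Y‖ ≤ 1},
          {f | s < ∑ i, ∑ j, f i j * Y.1 j i} := by
      ext f
      have htr : ∀ Y : Matrix (Fin b) (Fin a) ℝ,
          (Matrix.of f * Y).trace = ∑ i, ∑ j, f i j * Y j i := by
        intro Y
        simp [Matrix.trace, Matrix.mul_apply]
      simp only [Set.mem_preimage, Set.mem_Ioi, Set.mem_iUnion, Set.mem_ofPred_eq, ← htr]
      constructor
      · intro hs
        obtain ⟨Y, hY, h⟩ := exists_trace_mul_eq_nuclearNorm (Matrix.of f)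
        exact ⟨⟨Y, hY⟩, by rwa [h]⟩
      · rintro ⟨Y, hs⟩
        refine hs.trans_le ((trace_mul_le_nuclearNorm _ _).trans ?_)
        exact mul_le_of_le_one_left (nuclearNorm_nonneg _) Y.2
    rw [this]
    exact isOpen_iUnion fun Y => isOpen_lt continuous_const (by fun_prop)
  exact h.comp hM.curry

theorem MeasurableEntries.nuclearRank {M : X → Matrix (Fin a) (Fin b) ℝ}
    (hM : MeasurableEntries M) : Measurable fun x => nuclearRank (M x) :=
  (hM.nuclearNorm.pow_const 2).div (hM.frobNorm.pow_const 2)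

theorem measurableSet_largeNuclearRankEvent {d m k n : ℕ} (c ℓ u C₁ C₂ C₃ : ℝ)
    {A Abar : X → Matrix (Fin k) (Fin n) ℝ} {Wbar : X → Matrix (Fin m) (Fin k) ℝ}
    (hA : MeasurableEntries A) (hAbar : MeasurableEntries Abar) (hWbar : MeasurableEntries Wbar) :
    MeasurableSet (largeNuclearRankEvent d c ℓ u C₁ C₂ C₃ A Abar Wbar) := by
  have : largeNuclearRankEvent d c ℓ u C₁ C₂ C₃ A Abar Wbar =
      ⋂ t : ℕ, ⋂ (_ : C₁ * (d : ℝ) ^ (u - ℓ) * Real.log d ≤ t), ⋂ (_ : (t : ℝ) ≤ C₃ * (d : ℝ) ^ u),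
        {ω | C₂ * d ≤ MultiSpike.nuclearRank (matrixGradient (loss (A ω) (Abar ω) (Wbar ω))
          (gdIterate (A ω) (Abar ω) (Wbar ω) (1 / (c * MultiSpike.opNorm (MultiSpike.gram (A ω)))) t))} := by
    ext ω
    simp [largeNuclearRankEvent]
  rw [this]
  refine MeasurableSet.iInter fun t => MeasurableSet.iInter fun _ => MeasurableSet.iInter fun _ => ?_
  refine measurableSet_le measurable_const ?_
  simp only [matrixGradient_gdIterate]
  refine MeasurableEntries.nuclearRank (hWbar.mul ((hA.crossGram hAbar).mul (MeasurableEntries.pow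
    ((MeasurableEntries.const 1).sub (MeasurableEntries.smul ?_ hA.gram)) t))).neg
  exact measurable_const.div (measurable_const.mul hA.gram.opNorm)

end Measurability

/-! ### Conditional probability as the measure of a slice -/

section Conditional

/-- Conditional probability of an event that depends on two independent variables, given one of
them. -/
theorem condExp_indicator_prodMk_ae_eq {Ω α β : Type*} [MeasurableSpace Ω] [MeasurableSpace α]
    [mβ : MeasurableSpace β] {μ : Measure Ω} [IsProbabilityMeasure μ] {X : Ω → α} {Y : Ω → β}
    (hX : Measurable X) (hY : Measurable Y) (hXY : IndepFun X Y μ) {s : Set (α × β)}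
    (hs : MeasurableSet s) :
    μ⟦{ω | (X ω, Y ω) ∈ s} | mβ.comap Y⟧ =ᵐ[μ] fun ω => (μ.map X).real {x | (x, Y ω) ∈ s} := by
  have hm : mβ.comap Y ≤ ‹MeasurableSpace Ω› := hY.comap_le
  have hXp := Measure.isProbabilityMeasure_map (μ := μ) hX.aemeasurable
  have hYp := Measure.isProbabilityMeasure_map (μ := μ) hY.aemeasurable
  have hE : MeasurableSet {ω | (X ω, Y ω) ∈ s} := (hX.prodMk hY) hs
  have hg : Measurable fun y => (μ.map X).real {x | (x, y) ∈ s} :=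
    (measurable_measure_prodMk_right hs).ennreal_toReal
  have hgY : Measurable fun ω => (μ.map X).real {x | (x, Y ω) ∈ s} := hg.comp hY
  have hgint : Integrable (fun ω => (μ.map X).real {x | (x, Y ω) ∈ s}) μ :=
    Integrable.of_bound hgY.aestronglyMeasurable 1 (ae_of_all _ fun ω => by
      rw [Real.norm_of_nonneg measureReal_nonneg]
      exact measureReal_le_one)
  symm
  refine ae_eq_condExp_of_forall_setIntegral_eq hm ((integrable_const _).indicator hE)
    (fun _ _ _ => hgint.integrableOn) ?_ ?_
  · rintro _ ⟨t, ht, rfl⟩ -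
    rw [setIntegral_indicator hE, setIntegral_const, smul_eq_mul, mul_one]
    have h1 : μ (Y ⁻¹' t ∩ {ω | (X ω, Y ω) ∈ s}) =
        ∫⁻ y in t, μ.map X {x | (x, y) ∈ s} ∂(μ.map Y) := by
      have h2 : Y ⁻¹' t ∩ {ω | (X ω, Y ω) ∈ s} =
          (fun ω => (X ω, Y ω)) ⁻¹' (s ∩ Prod.snd ⁻¹' t) := by
        ext ω
        simp [and_comm]
      rw [h2, ← Measure.map_apply (hX.prodMk hY) (hs.inter (measurable_snd ht)),
        (indepFun_iff_map_prod_eq_prod_map_map hX.aemeasurable hY.aemeasurable).1 hXY,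
        Measure.prod_apply_symm (hs.inter (measurable_snd ht)), ← lintegral_indicator ht]
      refine lintegral_congr fun y => ?_
      by_cases hy : y ∈ t
      · simp [hy, Set.preimage]
      · have : (fun x : α => (x, y)) ⁻¹' (s ∩ Prod.snd ⁻¹' t) = ∅ := by
          ext x
          simp [hy]
        rw [this, Set.indicator_of_notMem hy, measure_empty]
    rw [← setIntegral_map (f := fun y => (μ.map X).real {x | (x, y) ∈ s}) ht
      hg.aestronglyMeasurable hY.aemeasurable, measureReal_def, h1]
    rw [integral_eq_lintegral_of_nonneg_ae (ae_of_all _ fun _ => measureReal_nonneg)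
      hg.aestronglyMeasurable]
    congr 1
    refine lintegral_congr fun y => ?_
    rw [ofReal_measureReal (measure_ne_top _ _)]
  · exact ((hg.comp (comap_measurable Y)).stronglyMeasurable).aestronglyMeasurable

end Conditional

/-! ### Nuclear rank outside the exceptional events -/

section NuclearRank

variable {m k n p : ℕ}

theorem frobNorm_smul_sq (s : ℝ) (M : Matrix (Fin m) (Fin k) ℝ) :
    frobNorm (s • M) ^ 2 = s ^ 2 * frobNorm M ^ 2 := by
  simp only [frobNorm_sq, Finset.mul_sum, Matrix.smul_apply, smul_eq_mul, mul_pow]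

theorem div_le_nuclearRank {M : Matrix (Fin m) (Fin k) ℝ} {x y : ℝ} (hx : 0 < x)
    (hM : x ≤ nuclearNorm M) (hy : frobNorm M ^ 2 ≤ y) : x ^ 2 / y ≤ nuclearRank M := by
  -- Division by zero would give nuclear rank 0, so the zero matrix must be excluded; its nuclear
  -- norm is 0 < x.
  have h0 : 0 < frobNorm M ^ 2 := by
    refine lt_of_le_of_ne (sq_nonneg _) fun h => ?_
    have hz : M = 0 := by
      rw [frobNorm_sq] at h
      ext i j
      have h1 := (Finset.sum_eq_zero_iff_of_nonneg fun i _ =>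
        Finset.sum_nonneg fun j _ => sq_nonneg (M i j)).1 h.symm i (Finset.mem_univ i)
      have h2 := (Finset.sum_eq_zero_iff_of_nonneg fun j _ => sq_nonneg (M i j)).1 h1 j
        (Finset.mem_univ j)
      exact pow_eq_zero_iff two_ne_zero |>.1 h2
    obtain ⟨Y, -, hY⟩ := exists_trace_mul_eq_nuclearNorm M
    rw [hz] at hY hM
    simp only [Matrix.zero_mul, Matrix.trace_zero] at hY
    linarith
  rw [nuclearRank]
  gcongr

open Classical in
/-- In the multi-spiked model, the nuclear rank of the gradient is of order `d` throughout the time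
window, except on an event of small Gaussian probability. -/
theorem MultiSpiked.gaussianMatrix_nuclearRank_lt_le {d r N : ℕ}
    {c₁ c₂ ℓ u c C₃ β θ bm bk εp : ℝ}
    (hc₁ : 0 < c₁) (hc₁₂ : c₁ ≤ c₂) (hu0 : 0 ≤ u) (hu : u ≤ 1) (hc : 1 ≤ c)
    (hd : 1 ≤ d) (hr : 0 < r) (hsep : c₂ < c₁ * (d : ℝ) ^ ℓ)
    (hstep : c₂ / (c₁ * (d : ℝ) ^ u) ≤ 1 / 2) (hβ : 0 < β) (hθ : 0 < θ) (hbm : 0 ≤ bm) (hbk : 0 ≤ bk)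
    (hm : (m : ℝ) ≤ bm * d) (hk : (k : ℝ) ≤ bk * d) (hNm : N ≤ m) (hN : θ * d / 2 ≤ N)
    (hNr : 2 * (β * d) ≤ r * c₁ ^ 2 - (2 * p + N) * c₂ ^ 2)
    (hp : (p : ℝ) * ((d : ℝ) ^ (u - ℓ)) ^ 2 ≤ εp * d)
    {A Abar : Matrix (Fin k) (Fin n) ℝ} (h : MultiSpiked d p r c₁ c₂ ℓ u A Abar) :
    gaussianMatrix m k {G | ¬ ∀ t : ℕ, 2 * c * c₂ / c₁ * (d : ℝ) ^ (u - ℓ) * Real.log d ≤ t →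
      (t : ℝ) ≤ C₃ * (d : ℝ) ^ u →
      β * θ ^ 2 / (16 * Real.exp (2 * C₃ * c₂ / (c * c₁)) ^ 2 *
        (2 * (3 * c₂ ^ 2 / c₁) ^ 2 + 2 * (c₂ ^ 2 * (bm * bk + 1)))) * d ≤
      nuclearRank (matrixGradient (loss A Abar (Matrix.of fun i j => (√(d : ℝ))⁻¹ * G i j))
        (gdIterate A Abar (Matrix.of fun i j => (√(d : ℝ))⁻¹ * G i j)
          (1 / (c * opNorm (gram A))) t))} ≤
      ENNReal.ofReal (bm * εp + bm * bk * chiSqVar / d ^ 2 +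
        2 * (bk * c₂ ^ 4 * chiSqVar / (β ^ 2 * d))) := by
  obtain ⟨D, V, S, hD, hV, hS, hSf, hwin⟩ :=
    h.exists_structure (C₃ := C₃) hc₁ hc₁₂ hu0 hu hc hd hr hsep hstep
  have hc₂ : 0 < c₂ := hc₁.trans_le hc₁₂
  have hd1 : (1 : ℝ) ≤ d := by exact_mod_cast hd
  have hd0 : (0 : ℝ) < d := by linarith
  have hcv := chiSqVar_nonneg
  set w := (d : ℝ) ^ (u - ℓ) with hw
  have hw0 : 0 < w := by positivity
  set ρ := Real.exp (2 * C₃ * c₂ / (c * c₁)) with hρ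
  have hρ0 : 0 < ρ := Real.exp_pos _
  -- Half of the guaranteed mean 2βd is kept as squared distance; after scaling by s = 1/√d each
  -- good row contributes √β.
  set τ := √(β * d) with hτ
  have hτ2 : τ ^ 2 = β * d := Real.sq_sqrt (by positivity)
  have hτ0 : 0 < τ := Real.sqrt_pos.2 (by positivity)
  have hεp : 0 ≤ εp := by
    by_contra! hneg
    have : 0 ≤ (p : ℝ) * w ^ 2 := by positivity
    nlinarith
  -- The threshold d²/w² leaves exactly order d after the spike amplification w² and the variance
  -- factor 1/d.
  set E₁ : Set (Fin m → Fin k → ℝ) := {G | (d : ℝ) ^ 2 / w ^ 2 ≤ frobNorm (Matrix.of G * V) ^ 2}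
  set E₂ : Set (Fin m → Fin k → ℝ) := {G | (m * k : ℝ) + (d : ℝ) ^ 2 ≤ frobNorm (Matrix.of G) ^ 2}
  set E₃ : Set (Fin m → Fin k → ℝ) :=
    {G | 2 * ((Finset.univ.filter fun i : Fin m => (i : ℕ) < N).filter fun i =>
        ¬ NearSpan D τ (fun i => rowImage S (G i)) i).card < N}
  have hP₁ : gaussianMatrix m k E₁ ≤ ENNReal.ofReal (bm * εp) := by
    refine (gaussianMatrix_frobNorm_mul_ge_le hV (by positivity)).trans
      (ENNReal.ofReal_le_ofReal ?_)
    calc (m : ℝ) * p / ((d : ℝ) ^ 2 / w ^ 2) = m * (p * w ^ 2) / d ^ 2 := by field_simp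
      _ ≤ (bm * d) * (εp * d) / d ^ 2 := by gcongr
      _ = bm * εp := by field_simp
  have hP₂ : gaussianMatrix m k E₂ ≤ ENNReal.ofReal (bm * bk * chiSqVar / d ^ 2) := by
    refine (gaussianMatrix_frobNorm_ge_le (by positivity)).trans (ENNReal.ofReal_le_ofReal ?_)
    calc (m : ℝ) * k * chiSqVar / ((d : ℝ) ^ 2) ^ 2 ≤
          (bm * d) * (bk * d) * chiSqVar / ((d : ℝ) ^ 2) ^ 2 := by gcongr
      _ = bm * bk * chiSqVar / d ^ 2 := by field_simp
  have hP₃ : gaussianMatrix m k E₃ ≤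
      ENNReal.ofReal (2 * (bk * c₂ ^ 4 * chiSqVar / (β ^ 2 * d))) := by
    have hh : 2 * (β * d) ≤ frobNorm S ^ 2 - (Module.finrank ℝ D + N : ℕ) * c₂ ^ 2 := by
      have h1 : ((Module.finrank ℝ D + N : ℕ) : ℝ) ≤ 2 * p + N := by
        have : Module.finrank ℝ D + N ≤ 2 * p + N := by omega
        exact_mod_cast this
      have h2 : ((Module.finrank ℝ D + N : ℕ) : ℝ) * c₂ ^ 2 ≤ (2 * p + N) * c₂ ^ 2 := by gcongr
      linarith
    have h1 : τ ^ 2 < 2 * (β * d) := by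
      rw [hτ2]
      have : 0 < β * d := by positivity
      linarith
    refine (gaussianMatrix_card_nearSpan_le D S hS hNm hh h1).trans (ENNReal.ofReal_le_ofReal ?_)
    rw [hτ2]
    calc 2 * ((k : ℝ) * c₂ ^ 4 * chiSqVar / (2 * (β * d) - β * d) ^ 2) ≤
          2 * ((bk * d) * c₂ ^ 4 * chiSqVar / (2 * (β * d) - β * d) ^ 2) := by gcongr
      _ = 2 * (bk * c₂ ^ 4 * chiSqVar / (β ^ 2 * d)) := by
        rw [two_mul (β * (d : ℝ)), add_sub_cancel_right]
        field_simp
  have hsub : ∀ G, G ∉ E₁ → G ∉ E₂ → G ∉ E₃ →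
      ∀ t : ℕ, 2 * c * c₂ / c₁ * w * Real.log d ≤ t →
      (t : ℝ) ≤ C₃ * (d : ℝ) ^ u →
      β * θ ^ 2 / (16 * ρ ^ 2 *
        (2 * (3 * c₂ ^ 2 / c₁) ^ 2 + 2 * (c₂ ^ 2 * (bm * bk + 1)))) * d ≤
      nuclearRank (matrixGradient (loss A Abar (Matrix.of fun i j => (√(d : ℝ))⁻¹ * G i j))
        (gdIterate A Abar (Matrix.of fun i j => (√(d : ℝ))⁻¹ * G i j)
          (1 / (c * opNorm (gram A))) t)) := by
    intro G hG₁ hG₂ hG₃ t ht₁ ht₂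
    simp only [E₁, E₂, E₃, Set.mem_ofPred_eq, not_le, not_lt] at hG₁ hG₂ hG₃
    obtain ⟨hfrob, R, hR, hRS⟩ := hwin t ht₁ ht₂
    set s := (√(d : ℝ))⁻¹ with hs
    have hs2 : s ^ 2 = (d : ℝ)⁻¹ := by rw [hs, inv_pow, Real.sq_sqrt hd0.le]
    have hs0 : 0 < s := inv_pos.2 (Real.sqrt_pos.2 hd0)
    have hsτ : s * τ = √β := by
      rw [hs, hτ, Real.sqrt_mul hβ.le]
      have := (Real.sqrt_pos.2 hd0).ne'
      field_simp
    have hWG : (Matrix.of fun i j => s * G i j : Matrix (Fin m) (Fin k) ℝ) = s • Matrix.of G := rfl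
    rw [hWG, matrixGradient_gdIterate]
    set P := (1 - (1 / (c * opNorm (gram A))) • gram A) ^ t
    set J := (Finset.univ.filter fun i : Fin m => (i : ℕ) < N).filter fun i =>
        ¬ NearSpan D τ (fun i => rowImage S (G i)) i
    have hJ : θ * d / 4 ≤ J.card := by
      have : (N : ℝ) ≤ 2 * J.card := by exact_mod_cast hG₃
      linarith
    have hnuc : √β * (θ * d / 4) / ρ ≤
        nuclearNorm (-(s • Matrix.of G * (crossGram A Abar * P))) := by
      refine le_trans ?_ (nuclearNorm_le_nuclearNorm_neg _)
      have h1 := card_mul_le_nuclearNorm (s • Matrix.of G * (crossGram A Abar * P)) (Matrix.of G) R S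
        D hs0.le hτ0 (fun x hx => by
          rw [Matrix.mul_assoc, toEuclideanLin_mul, hRS x hx, ← toEuclideanLin_mul, Matrix.smul_mul,
            map_smul, LinearMap.smul_apply]) J (fun i hi => (Finset.mem_filter.1 hi).2)
      rw [div_le_iff₀ hρ0]
      calc √β * (θ * d / 4) ≤ √β * J.card := by gcongr
        _ = s * (J.card * τ) := by rw [← hsτ]; ring
        _ ≤ _ := h1
        _ ≤ nuclearNorm (s • Matrix.of G * (crossGram A Abar * P)) * ρ := by
          rw [mul_comm]
          exact mul_le_mul_of_nonneg_left hR (nuclearNorm_nonneg _)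
    have hfr : frobNorm (-(s • Matrix.of G * (crossGram A Abar * P))) ^ 2 ≤
        (2 * (3 * c₂ ^ 2 / c₁) ^ 2 + 2 * (c₂ ^ 2 * (bm * bk + 1))) * d := by
      rw [frobNorm_neg]
      refine (hfrob _).trans ?_
      rw [Matrix.smul_mul, frobNorm_smul_sq, frobNorm_smul_sq, hs2]
      have h1 : (d : ℝ)⁻¹ * frobNorm (Matrix.of G * V) ^ 2 ≤ d / w ^ 2 := by
        calc (d : ℝ)⁻¹ * frobNorm (Matrix.of G * V) ^ 2 ≤ (d : ℝ)⁻¹ * ((d : ℝ) ^ 2 / w ^ 2) := by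
              gcongr
          _ = d / w ^ 2 := by field_simp
      have h2 : (d : ℝ)⁻¹ * frobNorm (Matrix.of G) ^ 2 ≤ (bm * bk + 1) * d := by
        calc (d : ℝ)⁻¹ * frobNorm (Matrix.of G) ^ 2 ≤
              (d : ℝ)⁻¹ * ((bm * d) * (bk * d) + (d : ℝ) ^ 2) := by
              gcongr
              refine hG₂.le.trans ?_
              gcongr
          _ = (bm * bk + 1) * d := by field_simp
      calc _ ≤ 2 * ((3 * c₂ ^ 2 / c₁ * w) ^ 2 * (d / w ^ 2)) +
              2 * (c₂ ^ 2 * ((bm * bk + 1) * d)) := by gcongr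
        _ = _ := by field_simp
    refine le_trans (le_of_eq ?_) (div_le_nuclearRank (by positivity) hnuc hfr)
    have hsq : (√β * (θ * d / 4) / ρ) ^ 2 = β * θ ^ 2 * d ^ 2 / (16 * ρ ^ 2) := by
      rw [div_pow, mul_pow, Real.sq_sqrt hβ.le]
      field_simp
      norm_num
    rw [hsq]
    have hK : 0 < 2 * (3 * c₂ ^ 2 / c₁) ^ 2 + 2 * (c₂ ^ 2 * (bm * bk + 1)) := by positivity
    generalize 2 * (3 * c₂ ^ 2 / c₁) ^ 2 + 2 * (c₂ ^ 2 * (bm * bk + 1)) = K at hK ⊢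
    field_simp
  calc _ ≤ gaussianMatrix m k (E₁ ∪ E₂ ∪ E₃) := by
        refine measure_mono fun G hG => ?_
        by_contra hcon
        simp only [Set.mem_union, not_or] at hcon
        exact hG (hsub G hcon.1.1 hcon.1.2 hcon.2)
    _ ≤ gaussianMatrix m k E₁ + gaussianMatrix m k E₂ + gaussianMatrix m k E₃ :=
        (measure_union_le _ _).trans (add_le_add_left (measure_union_le _ _) _)
    _ ≤ _ := by
        rw [ENNReal.ofReal_add (by positivity) (by positivity),
          ENNReal.ofReal_add (by positivity) (by positivity)]
        gcongr

end NuclearRank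

end MultiSpike

/-! ### Choice of constants and passage to the limit -/

theorem mainTheorem6
    (m k n p r : ℕ → ℕ) (c₁ c₂ ℓ u γ c : ℝ)
    (hc₁ : 0 < c₁) (hc₁₂ : c₁ ≤ c₂)
    (hℓ : 0 < ℓ) (hℓu : ℓ ≤ u) (hu : u ≤ 1) (hgap : u - ℓ < 1 / 2)
    (hγ : 0 < γ) (hc : 1 ≤ c)
    (hk : Tendsto (fun d : ℕ => (k d : ℝ) / d) atTop (𝓝 γ))
    (hm : (fun d : ℕ => (m d : ℝ)) =Θ[atTop] (fun d : ℕ => (d : ℝ)))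
    (hr : (fun d : ℕ => (r d : ℝ)) =Θ[atTop] (fun d : ℕ => (d : ℝ)))
    (hp : (fun d : ℕ => (p d : ℝ)) =o[atTop] (fun d : ℕ => (d : ℝ) ^ (1 - 2 * (u - ℓ))))
    (Ω : ℕ → Type*) [∀ d, MeasurableSpace (Ω d)]
    (μ : ∀ d, Measure (Ω d)) [∀ d, IsProbabilityMeasure (μ d)]
    (A Abar : ∀ d, Ω d → Matrix (Fin (k d)) (Fin (n d)) ℝ)
    (Wbar : ∀ d, Ω d → Matrix (Fin (m d)) (Fin (k d)) ℝ)
    (hA : ∀ d i j, Measurable fun ω => A d ω i j)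
    (hAbar : ∀ d i j, Measurable fun ω => Abar d ω i j)
    (hWbar : ∀ d i j, Measurable fun ω => Wbar d ω i j)
    (hgauss : ∀ d i j, HasLaw (fun ω => Wbar d ω i j) (gaussianReal 0 (d : ℝ≥0)⁻¹) (μ d))
    (hiid : ∀ d, iIndepFun (fun (ij : Fin (m d) × Fin (k d)) ω => Wbar d ω ij.1 ij.2) (μ d))
    (hindep : ∀ d, IndepFun (fun ω i j => Wbar d ω i j)
      (fun ω => (fun i j => A d ω i j, fun i j => Abar d ω i j)) (μ d)) :
    ∃ C₁ > 0, ∀ C₃ > 0, ∃ C₂ > 0, ∀ δ > 0, ∀ᶠ d in atTop,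
      ∀ᵐ ω ∂(μ d), MultiSpike.MultiSpiked d (p d) (r d) c₁ c₂ ℓ u (A d ω) (Abar d ω) →
        1 - δ ≤ ((μ d)⟦MultiSpike.largeNuclearRankEvent d c ℓ u C₁ C₂ C₃
          (A d) (Abar d) (Wbar d) | MultiSpike.sigmaPair (A d) (Abar d)⟧) ω := by
  have hc₂ : 0 < c₂ := hc₁.trans_le hc₁₂
  have hu0 : 0 < u := hℓ.trans_le hℓu
  obtain ⟨bm, hbm0, hbm⟩ := hm.1.exists_pos
  obtain ⟨am, ham0, ham⟩ := hm.2.exists_pos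
  obtain ⟨ar, har0, har⟩ := hr.2.exists_pos
  have hεp := hp.tendsto_div_nhds_zero
  -- Chosen so that r c₁² ≥ 4βd; the 2p dimensions of D and the N preceding rows may then each cost
  -- βd, leaving 2βd.
  set β : ℝ := c₁ ^ 2 / (4 * ar) with hβ
  have hβ0 : 0 < β := by positivity
  -- The first entry keeps N = ⌊θd⌋ ≤ m, the second keeps N c₂² ≤ βd.
  set θ : ℝ := min am⁻¹ (β / c₂ ^ 2) with hθ
  have hθ0 : 0 < θ := lt_min (by positivity) (by positivity)
  set bk : ℝ := γ + 1 with hbk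
  have hbk0 : 0 < bk := by positivity
  refine ⟨2 * c * c₂ / c₁, by positivity, fun C₃ hC₃ => ?_⟩
  refine ⟨β * θ ^ 2 / (16 * Real.exp (2 * C₃ * c₂ / (c * c₁)) ^ 2 *
    (2 * (3 * c₂ ^ 2 / c₁) ^ 2 + 2 * (c₂ ^ 2 * (bm * bk + 1)))), by positivity, fun δ hδ => ?_⟩
  have hcast : Tendsto (fun d : ℕ => (d : ℝ)) atTop atTop := tendsto_natCast_atTop_atTop
  have hsmall : Tendsto (fun d : ℕ => bm * ((p d : ℝ) / (d : ℝ) ^ (1 - 2 * (u - ℓ))) +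
      bm * bk * MultiSpike.chiSqVar / (d : ℝ) ^ 2 +
      2 * (bk * c₂ ^ 4 * MultiSpike.chiSqVar / (β ^ 2 * d))) atTop (𝓝 0) := by
    have h1 := hεp.const_mul bm
    have h2 : Tendsto (fun d : ℕ => bm * bk * MultiSpike.chiSqVar / (d : ℝ) ^ 2) atTop (𝓝 0) :=
      tendsto_const_nhds.div_atTop ((tendsto_pow_atTop two_ne_zero).comp hcast)
    have h3 : Tendsto (fun d : ℕ => bk * c₂ ^ 4 * MultiSpike.chiSqVar / (β ^ 2 * d)) atTop (𝓝 0) :=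
      tendsto_const_nhds.div_atTop (hcast.const_mul_atTop (by positivity))
    simpa using (h1.add h2).add (h3.const_mul 2)
  have hpow : ∀ {x : ℝ}, 0 < x → Tendsto (fun d : ℕ => (d : ℝ) ^ x) atTop atTop := fun hx =>
    (tendsto_rpow_atTop hx).comp hcast
  filter_upwards [eventually_ge_atTop 1, hbm.bound, ham.bound, har.bound,
    hk.eventually (eventually_lt_nhds (show γ < bk by linarith)),
    hsmall.eventually (eventually_lt_nhds hδ),
    hεp.eventually (eventually_lt_nhds (show 0 < β / (2 * c₂ ^ 2) by positivity)),
    (hpow hℓ).eventually (eventually_gt_atTop (c₂ / c₁)),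
    (hpow hu0).eventually (eventually_ge_atTop (2 * c₂ / c₁)),
    hcast.eventually (eventually_ge_atTop (2 / θ))]
    with d hd hmd hmd' hrd hkd hfail hpd hsep hstep hθd
  have hd1 : (1 : ℝ) ≤ d := by exact_mod_cast hd
  have hd0 : (0 : ℝ) < d := by linarith
  simp only [Real.norm_natCast] at hmd hmd' hrd
  have hm₁ : am⁻¹ * d ≤ m d := by
    rw [inv_mul_le_iff₀ ham0]
    exact hmd'
  have hr₁ : 4 * (β * d) ≤ r d * c₁ ^ 2 := by
    rw [hβ]
    calc 4 * (c₁ ^ 2 / (4 * ar) * d) = c₁ ^ 2 / ar * d := by field_simp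
      _ ≤ c₁ ^ 2 / ar * (ar * r d) := by gcongr
      _ = r d * c₁ ^ 2 := by field_simp
  have hr0 : 0 < r d := by
    rcases Nat.eq_zero_or_pos (r d) with h | h
    · rw [h] at hrd
      simp only [Nat.cast_zero, mul_zero] at hrd
      linarith
    · exact h
  have hk₁ : (k d : ℝ) ≤ bk * d := by
    rw [div_lt_iff₀ hd0] at hkd
    exact hkd.le
  set εp : ℝ := (p d : ℝ) / (d : ℝ) ^ (1 - 2 * (u - ℓ)) with hεpd
  have hexp : (d : ℝ) ^ (1 - 2 * (u - ℓ)) = d / ((d : ℝ) ^ (u - ℓ)) ^ 2 := by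
    rw [Real.rpow_sub hd0, Real.rpow_one, mul_comm, Real.rpow_mul hd0.le]
    norm_cast
  have hw0 : 0 < (d : ℝ) ^ (u - ℓ) := by positivity
  have hp₁ : (p d : ℝ) * ((d : ℝ) ^ (u - ℓ)) ^ 2 ≤ εp * d := by
    rw [hεpd, hexp]
    apply le_of_eq
    field_simp
  have hp₂ : (p d : ℝ) ≤ β / (2 * c₂ ^ 2) * d := by
    have hw1 : 1 ≤ ((d : ℝ) ^ (u - ℓ)) ^ 2 :=
      one_le_pow₀ (Real.one_le_rpow hd1 (by linarith))
    calc (p d : ℝ) ≤ p d * ((d : ℝ) ^ (u - ℓ)) ^ 2 := le_mul_of_one_le_right (by positivity) hw1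
      _ ≤ εp * d := hp₁
      _ ≤ _ := by gcongr
  have hfloor : (⌊θ * d⌋₊ : ℝ) ≤ θ * d := Nat.floor_le (by positivity)
  have hNm : ⌊θ * d⌋₊ ≤ m d := by
    have h1 : (⌊θ * d⌋₊ : ℝ) ≤ m d :=
      hfloor.trans ((mul_le_mul_of_nonneg_right (min_le_left _ _) hd0.le).trans hm₁)
    exact_mod_cast h1
  -- Rounding down loses less than 1, which is at most θd/2 once θd ≥ 2.
  have hN : θ * d / 2 ≤ ⌊θ * d⌋₊ := by
    have h1 := Nat.lt_floor_add_one (θ * d)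
    have h2 : 2 ≤ θ * d := by
      rw [div_le_iff₀ hθ0] at hθd
      linarith
    linarith
  have hNr : 2 * (β * d) ≤ r d * c₁ ^ 2 - (2 * p d + ⌊θ * d⌋₊) * c₂ ^ 2 := by
    have h1 : (p d : ℝ) * c₂ ^ 2 ≤ β / (2 * c₂ ^ 2) * d * c₂ ^ 2 := by gcongr
    have h2 : (⌊θ * d⌋₊ : ℝ) * c₂ ^ 2 ≤ β / c₂ ^ 2 * d * c₂ ^ 2 := by
      refine mul_le_mul_of_nonneg_right (hfloor.trans ?_) (by positivity)
      exact mul_le_mul_of_nonneg_right (min_le_right _ _) hd0.le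
    have h3 : β / (2 * c₂ ^ 2) * d * c₂ ^ 2 = β * d / 2 := by field_simp
    have h4 : β / c₂ ^ 2 * d * c₂ ^ 2 = β * d := by field_simp
    nlinarith
  have hsep' : c₂ < c₁ * (d : ℝ) ^ ℓ := by
    rw [div_lt_iff₀ hc₁] at hsep
    linarith
  have hstep' : c₂ / (c₁ * (d : ℝ) ^ u) ≤ 1 / 2 := by
    rw [div_le_iff₀ hc₁] at hstep
    rw [div_le_iff₀ (by positivity)]
    linarith
  let X : Ω d → (Fin (m d) → Fin (k d) → ℝ) := fun ω i j => Wbar d ω i j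
  let Y : Ω d → (Fin (k d) → Fin (n d) → ℝ) × (Fin (k d) → Fin (n d) → ℝ) :=
    fun ω => (fun i j => A d ω i j, fun i j => Abar d ω i j)
  have hX : Measurable X := MultiSpike.MeasurableEntries.curry (hWbar d)
  have hY : Measurable Y := (MultiSpike.MeasurableEntries.curry (hA d)).prodMk
    (MultiSpike.MeasurableEntries.curry (hAbar d))
  -- The event depends on ω only through (W̄, (A, Ā)); as a subset of the product space it can be
  -- sliced at the observed pair.
  let s : Set ((Fin (m d) → Fin (k d) → ℝ) ×
      ((Fin (k d) → Fin (n d) → ℝ) × (Fin (k d) → Fin (n d) → ℝ))) :=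
    MultiSpike.largeNuclearRankEvent d c ℓ u (2 * c * c₂ / c₁)
      (β * θ ^ 2 / (16 * Real.exp (2 * C₃ * c₂ / (c * c₁)) ^ 2 *
        (2 * (3 * c₂ ^ 2 / c₁) ^ 2 + 2 * (c₂ ^ 2 * (bm * bk + 1))))) C₃
      (fun x => Matrix.of x.2.1) (fun x => Matrix.of x.2.2) (fun x => Matrix.of x.1)
  have hs : MeasurableSet s := by
    refine MultiSpike.measurableSet_largeNuclearRankEvent c ℓ u _ _ C₃ ?_ ?_ ?_
    · exact fun i j => (measurable_pi_apply j).comp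
        ((measurable_pi_apply i).comp (measurable_fst.comp measurable_snd))
    · exact fun i j => (measurable_pi_apply j).comp
        ((measurable_pi_apply i).comp (measurable_snd.comp measurable_snd))
    · exact fun i j => (measurable_pi_apply j).comp ((measurable_pi_apply i).comp measurable_fst)
  have hcond := MultiSpike.condExp_indicator_prodMk_ae_eq hX hY (hindep d) hs
  filter_upwards [hcond] with ω hω hmodel
  refine le_trans ?_ (le_of_eq hω.symm)
  have hfailure := hmodel.gaussianMatrix_nuclearRank_lt_le (m := m d) (N := ⌊θ * d⌋₊) (C₃ := C₃)
    hc₁ hc₁₂ hu0.le hu hc hd hr0 hsep' hstep' hβ0 hθ0 hbm0.le hbk0.le hmd hk₁ hNm hN hNr hp₁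
  have hlaw : (μ d).map X = _ :=
    MultiSpike.map_eq_map_gaussianMatrix (hWbar d) (hgauss d) (hiid d)
  have hslice : MeasurableSet {x | (x, Y ω) ∈ s} := measurable_prodMk_right hs
  have hscale : Measurable fun (G : Fin (m d) → Fin (k d) → ℝ) i j => (√(d : ℝ))⁻¹ * G i j := by
    fun_prop
  rw [hlaw, map_measureReal_apply hscale hslice]
  have hcompl := probReal_compl_eq_one_sub (μ := MultiSpike.gaussianMatrix (m d) (k d))
    (hscale hslice)
  have hbound : (MultiSpike.gaussianMatrix (m d) (k d)).real
      ((fun (G : Fin (m d) → Fin (k d) → ℝ) i j => (√(d : ℝ))⁻¹ * G i j) ⁻¹'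
        {x | (x, Y ω) ∈ s})ᶜ ≤ δ := by
    refine ENNReal.toReal_le_of_le_ofReal hδ.le ?_
    exact hfailure.trans (ENNReal.ofReal_le_ofReal hfail.le)
  linarith
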